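/- **Compactness lemma.** Conventions. A probability space $(\mathbb I,\mu)$ is *atomless standard* if $\mathbb I$ is a standard Borel space and $\mu$ is a probability measure without atoms. For a real Hilbert space $\mathcal H$, a kernel $\boldsymbol w\in L^\infty(\mathbb I\times\mathbb I;\mathcal H)$ has cut norm $$\|\boldsymbol w\|_{\square;\mathcal H}=\sup_{\|\boldsymbol e\|_{\mathcal H}\le 1,\ S,T\subset\mathbb I\text{ measurable}}\Big\langle \boldsymbol e,\int_{S\times T}\boldsymbol w\,d\mu\otimes d\mu\Big\rangle_{\mathcal H},$$ and for kernels $\boldsymbol w_1$ on $\mathbb I_1\times\mathbb I_1$, $\boldsymbol w_2$ on $\mathbb I_2\times\mathbb I_2$ the unlabeled cut distance is $$\delta_{\square;\mathcal H}(\boldsymbol w_1,\boldsymbol w_2)=\inf_\Phi\|\boldsymbol w_1-\boldsymbol w_2(\Phi(\cdot),\Phi(\cdot))\|_{\square;\mathcal H},$$ over all bijective measure-preserving maps $\Phi:\mathbb I_1\to\mathbb I_2$. If a Banach space $\mathcal B$ is continuously embedded in $\mathcal H$, then $L^\infty(\mathbb I\times\mathbb I;\mathcal B)$ denotes the $\mathcal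 B$-valued functions that are (a.e.-strongly) measurable as functions into $\mathcal H$ and whose $\mathcal B$-norm is essentially bounded. Write $\mathcal B_{\le r}$ for the closed ball of radius $r$ of $\mathcal B$ around $0$. Let $(\mathbb I_n,\mu_n)$, $n\in\mathbb N$, and $(\mathbb I,\nu)$ be atomless standard probability spaces (for instance $\mathbb I=[0,1]$). **(1)** Let $\mathcal B$ be a real Banach space compactly embedded into a separable real Hilbert space $\mathcal H$ (the embedding is linear, injective, and maps bounded sets to relatively compact sets). Let $\boldsymbol w_n\in L^\infty(\mathbb I_n\times\mathbb I_n;\mathcal B)$ satisfy $\|\boldsymbol w_n\|_{\mathcal B}\le w_{\max}<\infty$ a.e. for all $n$. Then there are a subsequence $(\boldsymbol w_{n_k})_k$ and a kernel $\boldsymbol w\in L^\infty(\mathbb I\times\mathbb I;\mathcal H)$ with values a.e. in the $\mathcal H$-closure of $\mathcal B_{\le w_{\max}}$ such that $$\lim_{k\to\infty}\delta_{\square;\mathcal H}(\boldsymbol w_{n_k},\boldsymbol w)=0.$$ If moreover $\mathcal B_{\le 1}$ is closed in $\mathcal H$ (equivalently, compact in $\mathcal H$), then $\boldsymbol w\in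 L^\infty(\mathbb I\times\mathbb I;\mathcal B)$, up to modification on a null set. **(2)** Let $\mathbb T=\mathbb R/\mathbb Z$, and let $H^{-1}(\mathbb T)$ be the Hilbert space of distributions with norm $\|f\|_{H^{-1}}^2=\sum_{m\in\mathbb Z}(1+4\pi^2m^2)^{-1}|\hat f(m)|^2$. For $w\in L^\infty(\mathbb I\times\mathbb I;\mathbb R)$ and measurable $X:\mathbb I\to\mathbb T$ put $$\boldsymbol w_{w,X}(\xi,\zeta)=\big(\delta_{X(\zeta)},\ w(\xi,\zeta)\,\delta_{X(\zeta)}\big)\in\mathcal H:=H^{-1}(\mathbb T)\oplus H^{-1}(\mathbb T).$$ Let $w^{(n)}\in L^\infty(\mathbb I_n\times\mathbb I_n;\mathbb R)$ with $|w^{(n)}|\le w_{\max}<\infty$ a.e. for all $n$, and let $X^{(n)}:\mathbb I_n\to\mathbb T$ be measurable. Then there are a subsequence $(n_k)_k$, a function $w\in L^\infty(\mathbb I\times\mathbb I;\mathbb R)$ and a measurable $X:\mathbb I\to\mathbb T$ such that $$\lim_{k\to\infty}\delta_{\square;\mathcal H}\big(\boldsymbol w_{w^{(n_k)},X^{(n_k)}},\boldsymbol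 w_{w,X}\big)=0.$$ Moreover every limit has this form: if $(n_k)_k$ is any strictly increasing sequence and $\boldsymbol u\in L^\infty(\mathbb I\times\mathbb I;\mathcal H)$ satisfies $\delta_{\square;\mathcal H}(\boldsymbol w_{w^{(n_k)},X^{(n_k)}},\boldsymbol u)\to0$, then $\boldsymbol u=\boldsymbol w_{w,X}$ a.e. for some $w\in L^\infty(\mathbb I\times\mathbb I;\mathbb R)$ and some measurable $X:\mathbb I\to\mathbb T$. -/

import Mathlib

open MeasureTheory Filter Topology
open scoped ENNReal

noncomputable section

namespace CutCompactness

/-- `w ∈ L^∞(Ω; B)` for a Banach space `B` regarded as a subspace of the Hilbert space `H` through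
the embedding `ι`: a `B`-valued function, measurable as a map into `H`, whose `B`-norm is
essentially bounded. (Strong measurability for the norm of `B` would exclude kernels such as
`ζ ↦ δ_ζ`, with `B` the non-separable space of measures with the total variation norm.) -/
structure MemLInfty {Ω B H : Type*} [MeasurableSpace Ω] [NormedAddCommGroup B] [NormedSpace ℝ B]
    [NormedAddCommGroup H] [NormedSpace ℝ H] (ι : B →L[ℝ] H) (P : Measure Ω) (w : Ω → B) :
    Prop where
  measurable : AEStronglyMeasurable (fun p => ι (w p)) P
  bounded : ∃ C : ℝ, ∀ᵐ p ∂P, ‖w p‖ ≤ C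

/-- The embedding `ι` of `B` into `H` is compact: it is injective and maps bounded sets to relatively
compact sets. -/
structure IsCompactEmbedding {B H : Type*} [NormedAddCommGroup B] [NormedSpace ℝ B]
    [NormedAddCommGroup H] [NormedSpace ℝ H] (ι : B →L[ℝ] H) : Prop where
  injective : Function.Injective ι
  compact : IsCompactOperator ι

section CutDistance

variable {I J H : Type*} [MeasurableSpace I] [MeasurableSpace J]
  [NormedAddCommGroup H] [InnerProductSpace ℝ H]

/-- The cut norm of an `H`-valued kernel on `I × J`: the supremum of
`⟪e, ∫_{S × T} w⟫` over `‖e‖ ≤ 1` and measurable `S ⊆ I`, `T ⊆ J`. The choice `e = 0` shows that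
the supremum is nonnegative, so that it may be taken in `[0, ∞]`. -/
def cutNorm (μ : Measure I) (ν : Measure J) (w : I × J → H) : ℝ≥0∞ :=
  ⨆ (e : H) (_ : ‖e‖ ≤ 1) (S : Set I) (_ : MeasurableSet S) (T : Set J) (_ : MeasurableSet T),
    ENNReal.ofReal (inner ℝ e (∫ p in S ×ˢ T, w p ∂(μ.prod ν)))

/-- The unlabeled cut distance between kernels `w₁` on `I × I` and `w₂` on `J × J`: the infimum of
the cut norm of `w₁ - w₂(Φ(·), Φ(·))` over all bijective measure-preserving maps `Φ : I → J`. -/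
def cutDist (μ : Measure I) (ν : Measure J) (w₁ : I × I → H) (w₂ : J × J → H) : ℝ≥0∞ :=
  ⨅ (Φ : I → J) (_ : Function.Bijective Φ) (_ : MeasurePreserving Φ μ ν),
    cutNorm μ μ (fun p => w₁ p - w₂ (Φ p.1, Φ p.2))

end CutDistance

/-- The Sobolev space `H^{-1}` of the torus `ℝ / ℤ`. A distribution `f` with Fourier coefficients
`f̂ m` is recorded by the square-summable sequence `(1 + 4 π² m²)^{-1/2} f̂ m`, so that
`‖f‖² = ∑ m, (1 + 4 π² m²)^{-1} |f̂ m|²`. -/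
abbrev HNegOne : Type := lp (fun _ : ℤ => ℂ) 2

/-- The `m`-th Fourier coefficient `∫ e^{-2 π i m x} dP(x)` of a measure on the torus. -/
def fourierCoeffMeasure (P : Measure UnitAddCircle) (m : ℤ) : ℂ :=
  ∫ x, fourier (-m) x ∂P

/-- The weighted Fourier coefficients that represent a measure as an element of `H^{-1}`. -/
def weightedCoeff (P : Measure UnitAddCircle) (m : ℤ) : ℂ :=
  ((√(1 + 4 * Real.pi ^ 2 * (m : ℝ) ^ 2))⁻¹ : ℝ) • fourierCoeffMeasure P m

theorem memlp_weightedCoeff (P : Measure UnitAddCircle) [IsFiniteMeasure P] :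
    Memℓp (weightedCoeff P) 2 := by
  rw [memℓp_gen_iff (by norm_num)]
  have h2 : (2 : ℝ≥0∞).toReal = (2 : ℕ) := by norm_num
  simp only [h2, Real.rpow_natCast]
  have hs : Summable fun m : ℤ => P.real Set.univ ^ 2 * (1 / (m : ℝ) ^ 2) :=
    (Real.summable_one_div_int_pow.mpr (by norm_num)).mul_left _
  refine hs.of_norm_bounded_eventually ?_
  have h0 : ∀ᶠ m : ℤ in cofinite, m ≠ 0 := by
    exact (Set.finite_singleton (0 : ℤ)).subset fun m hm => not_not.mp hm
  filter_upwards [h0] with m hm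
  have hm' : (0 : ℝ) < (m : ℝ) ^ 2 := by positivity
  have hc : ‖fourierCoeffMeasure P m‖ ≤ P.real Set.univ := by
    have := norm_integral_le_of_norm_le_const (μ := P) (C := 1)
      (f := fun x : UnitAddCircle => fourier (-m) x)
      (Eventually.of_forall fun x => by rw [fourier_apply, Circle.norm_coe])
    simpa [fourierCoeffMeasure] using this
  have hpi : (1 : ℝ) ≤ Real.pi := by linarith [Real.pi_gt_three]
  have hw : (0 : ℝ) < 1 + 4 * Real.pi ^ 2 * (m : ℝ) ^ 2 := by positivity
  rw [Real.norm_of_nonneg (by positivity), weightedCoeff, norm_smul, mul_pow, norm_inv,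
    Real.norm_of_nonneg (Real.sqrt_nonneg _), inv_pow, Real.sq_sqrt hw.le, mul_comm]
  have hle : (m : ℝ) ^ 2 ≤ 1 + 4 * Real.pi ^ 2 * (m : ℝ) ^ 2 := by
    nlinarith [mul_le_mul_of_nonneg_right (one_le_pow₀ hpi : 1 ≤ Real.pi ^ 2) hm'.le]
  rw [one_div]
  gcongr

/-- The canonical embedding of (nonnegative finite) measures on the torus into `H^{-1}`. -/
def measureToHNegOne (P : Measure UnitAddCircle) [IsFiniteMeasure P] : HNegOne :=
  ⟨weightedCoeff P, memlp_weightedCoeff P⟩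

/-- The kernel `(ξ, ζ) ↦ (δ_{X ζ}, w(ξ, ζ) δ_{X ζ})` associated with a pair `(w, X)`, with values in
the Hilbert space `H^{-1} ⊕ H^{-1}`. -/
def pairKernel {I : Type*} (w : I × I → ℝ) (X : I → UnitAddCircle) :
    I × I → PiLp 2 (fun _ : Fin 2 => HNegOne) :=
  fun p => WithLp.toLp 2
    ![measureToHNegOne (Measure.dirac (X p.2)), w p • measureToHNegOne (Measure.dirac (X p.2))]

end CutCompactness

end

/-! Any two atomless standard probability spaces are isomorphic, so all kernels can be moved to the
one space `(J, ν)` at no cost in cut distance. Compactness of the embedding makes the closure `K` of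
the image of the ball compact, and it is convex. The heart of the matter is then
`compactSpace_kernelsIn`: kernels with values in a compact convex `K` form a compact pseudometric
space for the cut distance.

Total boundedness is weak regularity. A finite net of `K` reduces a kernel to finitely many
indicators; greedy approximation in L² replaces each by a bounded number of rectangles, with small
error in cut norm (`exists_rectangle_approx`). Rounding coefficients, every kernel is close to a
matrix from a fixed finite list, spread along a finite partition. Two kernels with the same matrix
and almost the same cell masses are close in cut distance, since without atoms the cells can be
matched by an isomorphism (`exists_rearrangement`).

Completeness: composing near-optimal isomorphisms turns a rapidly Cauchy sequence for the distance
into one for the cut norm. It is bounded in L², so it has a weak limit; the cut norm is weakly lower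
semicontinuous, and convexity keeps the values in `K`.

For pairs, the values `(δ_x, c δ_x)` fill a compact set that is not convex, so compactness is
applied to its closed convex hull and the limit is identified afterwards. The first component
depends on `ζ` alone, and for such functions cut norm convergence controls a Fourier coefficient in
L¹. Hence the positions converge almost everywhere along a subsequence, while the weights converge
weakly. The product of a strong and a weak limit passes to the limit, so the limit is again the
kernel of a pair (`exists_pair_of_tendsto_cutNorm`). -/

noncomputable section

namespace CutCompactness

/-! ### Distribution functions of atomless laws on the line -/

/-- The distribution function of a law on the line, as a map to the unit interval. -/
def cdfUnit (P : Measure ℝ) (x : ℝ) : unitInterval :=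
  ⟨ProbabilityTheory.cdf P x, ProbabilityTheory.cdf_nonneg P x, ProbabilityTheory.cdf_le_one P x⟩

theorem monotone_cdfUnit (P : Measure ℝ) : Monotone (cdfUnit P) := fun _ _ h =>
  ProbabilityTheory.monotone_cdf P h

theorem measurable_cdfUnit (P : Measure ℝ) : Measurable (cdfUnit P) :=
  (monotone_cdfUnit P).measurable

theorem continuous_cdf (P : Measure ℝ) [IsProbabilityMeasure P] [NullSingletonClass P] :
    Continuous (ProbabilityTheory.cdf P) := by
  rw [continuous_iff_continuousAt]
  intro x
  rw [(ProbabilityTheory.cdf P).mono.continuousAt_iff_leftLim_eq_rightLim,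
    StieltjesFunction.rightLim_eq]
  have h := (ProbabilityTheory.cdf P).measure_singleton x
  rw [ProbabilityTheory.measure_cdf, measure_singleton] at h
  have h1 := ENNReal.ofReal_eq_zero.mp h.symm
  have h2 := (ProbabilityTheory.cdf P).mono.leftLim_le (le_refl x)
  linarith

/-- Continuity makes every level strictly between 0 and 1 a value of the distribution function. The
lower bound uses a point at level `t`; the upper bound uses points at levels slightly above `t`,
whose half-lines contain the sublevel set even if the function is flat at `t`. -/
theorem measure_cdf_le (P : Measure ℝ) [IsProbabilityMeasure P] [NullSingletonClass P]
    {t : ℝ} (ht0 : 0 ≤ t) (ht1 : t ≤ 1) :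
    P {x | ProbabilityTheory.cdf P x ≤ t} = ENNReal.ofReal t := by
  have hex : ∀ s : ℝ, 0 < s → s < 1 → ∃ x, ProbabilityTheory.cdf P x = s := by
    intro s hs0 hs1
    obtain ⟨a, ha⟩ := ((ProbabilityTheory.tendsto_cdf_atBot P).eventually
      (gt_mem_nhds hs0)).exists
    obtain ⟨b, hb⟩ := ((ProbabilityTheory.tendsto_cdf_atTop P).eventually
      (lt_mem_nhds hs1)).exists
    exact mem_range_of_exists_le_of_exists_ge (continuous_cdf P) ⟨a, ha.le⟩ ⟨b, hb.le⟩
  have hIic : ∀ x, P (Set.Iic x) = ENNReal.ofReal (ProbabilityTheory.cdf P x) := fun x =>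
    (ProbabilityTheory.ofReal_cdf P x).symm
  apply le_antisymm
  · rcases eq_or_lt_of_le ht1 with rfl | ht1
    · simpa using prob_le_one
    refine le_of_forall_gt_imp_ge_of_dense fun c hc => ?_
    have hc1 : ENNReal.ofReal t < min c 1 := lt_min hc (by simpa using ht1)
    obtain ⟨r, hr1, hr2⟩ := ENNReal.lt_iff_exists_nnreal_btwn.mp hc1
    have hr3 : t < r := (ENNReal.ofReal_lt_coe_iff ht0).mp hr1
    have hr4 : (r : ℝ) < 1 := by
      have := hr2.trans_le (min_le_right _ _)
      exact_mod_cast this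
    obtain ⟨x, hx⟩ := hex r (ht0.trans_lt hr3) hr4
    calc P {x | ProbabilityTheory.cdf P x ≤ t} ≤ P (Set.Iic x) := by
          refine measure_mono fun y hy => ?_
          by_contra hxy
          have := (ProbabilityTheory.monotone_cdf P) (not_le.mp hxy).le
          change ProbabilityTheory.cdf P y ≤ t at hy
          linarith
      _ = r := by rw [hIic, hx]; simp
      _ ≤ c := (hr2.trans_le (min_le_left _ _)).le
  · rcases eq_or_lt_of_le ht0 with rfl | ht0
    · simp
    rcases eq_or_lt_of_le ht1 with rfl | ht1
    · have : {x | ProbabilityTheory.cdf P x ≤ 1} = Set.univ := by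
        ext x; simp [ProbabilityTheory.cdf_le_one]
      simp [this]
    obtain ⟨x, hx⟩ := hex t ht0 ht1
    rw [← hx, ← hIic]
    exact measure_mono fun y hy => ProbabilityTheory.monotone_cdf P hy

theorem measurePreserving_cdfUnit (P : Measure ℝ) [IsProbabilityMeasure P]
    [NullSingletonClass P] : MeasurePreserving (cdfUnit P) P volume := by
  refine ⟨measurable_cdfUnit P, ?_⟩
  have : IsProbabilityMeasure (P.map (cdfUnit P)) :=
    Measure.isProbabilityMeasure_map (measurable_cdfUnit P).aemeasurable
  refine Measure.ext_of_Iic _ _ fun t => ?_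
  rw [Measure.map_apply (measurable_cdfUnit P) measurableSet_Iic, unitInterval.volume_Iic]
  exact measure_cdf_le P t.2.1 t.2.2

/-- A nonatomic distribution function is injective off a null set. -/
theorem exists_injOn_cdfUnit (P : Measure ℝ) [IsProbabilityMeasure P] [NullSingletonClass P] :
    ∃ N : Set ℝ, MeasurableSet N ∧ P N = 0 ∧ Set.InjOn (cdfUnit P) Nᶜ := by
  -- Injectivity fails only on flat pieces. The removed set consists of the points that have a
  -- rational to their left at the same level; of two distinct points at one level, the larger is
  -- always removed.
  refine ⟨⋃ q : ℚ, Set.Ioi (q : ℝ) ∩ cdfUnit P ⁻¹' {cdfUnit P q}, ?_, ?_, ?_⟩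
  · exact MeasurableSet.iUnion fun q => measurableSet_Ioi.inter
      (measurable_cdfUnit P (measurableSet_singleton _))
  · refine measure_iUnion_null fun q => measure_mono_null Set.inter_subset_right ?_
    rw [(measurePreserving_cdfUnit P).measure_preimage (measurableSet_singleton _).nullMeasurableSet]
    simp
  · have key : ∀ x y : ℝ, x < y → cdfUnit P x = cdfUnit P y →
        y ∈ ⋃ q : ℚ, Set.Ioi (q : ℝ) ∩ cdfUnit P ⁻¹' {cdfUnit P q} := by
      intro x y hxy h
      obtain ⟨q, hq1, hq2⟩ := exists_rat_btwn hxy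
      refine Set.mem_iUnion.mpr ⟨q, hq2, ?_⟩
      exact le_antisymm (h ▸ monotone_cdfUnit P hq1.le) (monotone_cdfUnit P hq2.le)
    intro x hx y hy h
    by_contra hne
    rcases lt_or_gt_of_ne hne with hlt | hlt
    · exact hy (key x y hlt h)
    · exact hx (key y x hlt h.symm)

theorem not_countable_of_measure_ne_zero {I : Type*} [MeasurableSpace I] (μ : Measure I)
    [NullSingletonClass μ] (h : μ ≠ 0) : ¬ Countable I := fun _ => h <| by
  rw [← Measure.measure_univ_eq_zero]
  exact Set.countable_univ.measure_zero μ

/-! ### Isomorphisms of atomless standard probability spaces -/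

section Isomorphism

variable {I : Type*} [MeasurableSpace I] [StandardBorelSpace I]

/-- An atomless probability measure on a standard Borel space has an uncountable null set. -/
theorem exists_null_not_countable (μ : Measure I) [IsProbabilityMeasure μ]
    [NullSingletonClass μ] : ∃ C : Set I, MeasurableSet C ∧ μ C = 0 ∧ ¬ C.Countable := by
  have hI := not_countable_of_measure_ne_zero μ (IsProbabilityMeasure.ne_zero μ)
  have hR : ¬ Countable ℝ := fun _ => Cardinal.not_countable_real Set.countable_univ
  have hR2 : ¬ Countable (ℝ × ℝ) := fun _ =>
    hR (Function.LeftInverse.injective (f := fun x : ℝ => (x, x)) (g := Prod.fst)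
      fun _ => rfl).countable
  -- The vertical lines are uncountably many disjoint uncountable sets, and only countably many of
  -- them can have positive measure.
  let e : I ≃ᵐ ℝ × ℝ := PolishSpace.measurableEquivOfNotCountable hI hR2
  let A : ℝ → Set I := fun x => e ⁻¹' (Prod.fst ⁻¹' {x})
  have hA : ∀ x, MeasurableSet (A x) := fun x =>
    e.measurable (measurable_fst (measurableSet_singleton x))
  have hdisj : Pairwise (Function.onFun Disjoint A) := by
    intro x y hxy
    refine Set.disjoint_left.mpr fun p hp hq => hxy ?_
    exact (show (e p).1 = x from hp).symm.trans hq
  have hcount := Measure.countable_meas_pos_of_disjoint_iUnion (μ := μ) hA hdisj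
  have hne : ∃ x, x ∉ {x | 0 < μ (A x)} := by
    by_contra! hall
    exact Cardinal.not_countable_real (hcount.mono fun x _ => hall x)
  obtain ⟨x, hx⟩ := hne
  refine ⟨A x, hA x, by simpa using hx, fun hc => ?_⟩
  refine Cardinal.not_countable_real ((hc.image fun p => (e p).2).mono fun y _ => ?_)
  exact ⟨e.symm (x, y), by simp [A], by simp⟩

/-- An almost everywhere injective measure-preserving map between atomless standard probability
spaces agrees almost everywhere with an isomorphism. -/
theorem exists_measurableEquiv_of_injOn {J : Type*} [MeasurableSpace J] [StandardBorelSpace J]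
    (μ : Measure I) [IsProbabilityMeasure μ] [NullSingletonClass μ]
    (ν : Measure J) [IsProbabilityMeasure ν] [NullSingletonClass ν]
    {G : I → J} (hG : MeasurePreserving G μ ν) {N : Set I} (hN : MeasurableSet N) (hN0 : μ N = 0)
    (hinj : Set.InjOn G Nᶜ) :
    ∃ θ : I ≃ᵐ J, MeasurePreserving θ μ ν ∧ θ =ᵐ[μ] G := by
  classical
  -- Discarding the uncountable null sets `C` and `G ⁻¹' D` makes both leftover sets uncountable.
  -- They are then Borel isomorphic, and `G` can be completed to a bijection.
  obtain ⟨C, hC, hC0, hCc⟩ := exists_null_not_countable μ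
  obtain ⟨D, hD, hD0, hDc⟩ := exists_null_not_countable ν
  set A : Set I := (N ∪ C ∪ G ⁻¹' D)ᶜ with hA
  have hAm : MeasurableSet A := ((hN.union hC).union (hG.measurable hD)).compl
  have hA0 : μ Aᶜ = 0 := by
    rw [hA, compl_compl]
    refine measure_union_null (measure_union_null hN0 hC0) ?_
    rw [hG.measure_preimage hD.nullMeasurableSet, hD0]
  have hinjA : Set.InjOn G A := hinj.mono fun x hx hxN => hx (Or.inl (Or.inl hxN))
  have hGA : MeasurableSet (G '' A) := hAm.image_of_measurable_injOn hG.measurable hinjA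
  have : StandardBorelSpace A := hAm.standardBorel
  have : StandardBorelSpace (Aᶜ : Set I) := hAm.compl.standardBorel
  have : StandardBorelSpace ((G '' A)ᶜ : Set J) := hGA.compl.standardBorel
  have h1 : ¬ Countable (Aᶜ : Set I) := fun h =>
    hCc ((Set.countable_coe_iff.mp h).mono fun x hx => by simp [A, hx])
  have h2 : ¬ Countable ((G '' A)ᶜ : Set J) := fun h =>
    hDc ((Set.countable_coe_iff.mp h).mono fun y hy => by
      rintro ⟨x, hx, rfl⟩
      exact hx (Or.inr hy))
  let e : (Aᶜ : Set I) ≃ᵐ ((G '' A)ᶜ : Set J) := PolishSpace.measurableEquivOfNotCountable h1 h2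
  let θ : I → J := fun x => if hx : x ∈ A then G x else e ⟨x, hx⟩
  have hθm : Measurable θ := by
    refine Measurable.dite (hG.measurable.comp measurable_subtype_coe)
      (measurable_subtype_coe.comp e.measurable) hAm
  have hθA : ∀ x ∈ A, θ x = G x := fun x hx => by simp [θ, hx]
  have hθA' : ∀ x (hx : x ∉ A), θ x = e ⟨x, hx⟩ := fun x hx => by simp [θ, hx]
  have hθinj : Function.Injective θ := by
    intro x y hxy
    by_cases hx : x ∈ A <;> by_cases hy : y ∈ A
    · rw [hθA x hx, hθA y hy] at hxy
      exact hinjA hx hy hxy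
    · rw [hθA x hx, hθA' y hy] at hxy
      exact absurd ⟨x, hx, hxy⟩ (e ⟨y, hy⟩).2
    · rw [hθA' x hx, hθA y hy] at hxy
      exact absurd ⟨y, hy, hxy.symm⟩ (e ⟨x, hx⟩).2
    · rw [hθA' x hx, hθA' y hy] at hxy
      have := e.injective (Subtype.ext hxy)
      exact congrArg Subtype.val this
  have hθsurj : Function.Surjective θ := by
    intro y
    by_cases hy : y ∈ G '' A
    · obtain ⟨x, hx, rfl⟩ := hy
      exact ⟨x, hθA x hx⟩
    · refine ⟨(e.symm ⟨y, hy⟩ : (Aᶜ : Set I)), ?_⟩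
      rw [hθA' _ (e.symm ⟨y, hy⟩).2]
      simp
  have hae : θ =ᵐ[μ] G := by
    refine measure_mono_null (fun x hx => ?_) hA0
    exact fun hxA => hx (hθA x hxA)
  have hemb := hθm.measurableEmbedding hθinj
  let E : I ≃ᵐ J := ⟨Equiv.ofBijective θ ⟨hθinj, hθsurj⟩, hθm, by
    intro s hs
    rw [← Equiv.image_eq_preimage_symm]
    exact hemb.measurableSet_image.mpr hs⟩
  exact ⟨E, ⟨hθm, (Measure.map_congr hae).trans hG.map_eq⟩, hae⟩

/-- A bijective measure-preserving map between standard Borel spaces is an isomorphism. -/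
theorem exists_measurableEquiv_of_bijective {J : Type*} [MeasurableSpace J]
    [StandardBorelSpace J] {Φ : I → J} (hΦ : Function.Bijective Φ) (hm : Measurable Φ) :
    ∃ θ : I ≃ᵐ J, ⇑θ = Φ := by
  have hemb := hm.measurableEmbedding hΦ.1
  exact ⟨⟨Equiv.ofBijective Φ hΦ, hm, by
    intro s hs
    rw [← Equiv.image_eq_preimage_symm]
    exact hemb.measurableSet_image.mpr hs⟩, rfl⟩

/-- The isomorphism theorem for an atomless standard probability space, ordered by an injective
measurable real function. -/
theorem exists_measurableEquiv_cdfUnit (μ : Measure I) [IsProbabilityMeasure μ]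
    [NullSingletonClass μ] {f : I → ℝ} (hf : Measurable f) (hinj : Function.Injective f) :
    ∃ θ : I ≃ᵐ unitInterval, MeasurePreserving θ μ volume ∧
      θ =ᵐ[μ] fun x => cdfUnit (μ.map f) (f x) := by
  have hP : IsProbabilityMeasure (μ.map f) := Measure.isProbabilityMeasure_map hf.aemeasurable
  have hna : NullSingletonClass (μ.map f) := ⟨fun x => by
    rw [Measure.map_apply hf (measurableSet_singleton x)]
    exact (Set.subsingleton_singleton.preimage hinj).measure_zero μ⟩
  obtain ⟨N, hN, hN0, hNinj⟩ := exists_injOn_cdfUnit (μ.map f)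
  refine exists_measurableEquiv_of_injOn μ volume
    (G := fun x => cdfUnit (μ.map f) (f x)) (N := f ⁻¹' N) ?_ (hf hN) ?_ ?_
  · exact (measurePreserving_cdfUnit (μ.map f)).comp ⟨hf, rfl⟩
  · rwa [← Measure.map_apply hf hN]
  · intro x hx y hy h
    exact hinj (hNinj hx hy h)

/-- Any natural-number-valued function on an atomless standard probability space becomes a monotone
step function after a suitable identification with the unit interval. -/
theorem exists_measurableEquiv_sublevel (μ : Measure I) [IsProbabilityMeasure μ]
    [NullSingletonClass μ] {h : I → ℕ} (hh : Measurable h) :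
    ∃ θ : I ≃ᵐ unitInterval, MeasurePreserving θ μ volume ∧
      ∀ i : ℕ, {x | h x ≤ i} =ᵐ[μ] {x | (θ x : ℝ) ≤ μ.real {x | h x ≤ i}} := by
  have hI := not_countable_of_measure_ne_zero μ (IsProbabilityMeasure.ne_zero μ)
  have hU : ¬ Countable (Set.Ioo (0 : ℝ) 1) := fun hc => by
    have := Set.countable_coe_iff.mp hc
    have := this.measure_zero volume
    simp at this
  have : StandardBorelSpace (Set.Ioo (0 : ℝ) 1) := measurableSet_Ioo.standardBorel
  let g : I ≃ᵐ Set.Ioo (0 : ℝ) 1 := PolishSpace.measurableEquivOfNotCountable hI hU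
  -- Since `g` takes values in the open unit interval, `f` is injective and sorts points first by
  -- `h`; the sublevel `h ≤ i` is exactly `f ≤ i + 1`.
  let f : I → ℝ := fun x => h x + g x
  have hg0 : ∀ x, (0 : ℝ) < g x := fun x => (g x).2.1
  have hg1 : ∀ x, (g x : ℝ) < 1 := fun x => (g x).2.2
  have hf : Measurable f := ((measurable_from_nat (f := fun n : ℕ => (n : ℝ))).comp hh).add
    (measurable_subtype_coe.comp g.measurable)
  have hle : ∀ x (i : ℕ), f x ≤ i + 1 ↔ h x ≤ i := by
    intro x i
    constructor
    · intro hx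
      have h1 : (h x : ℝ) < ((i + 1 : ℕ) : ℝ) := by
        push_cast
        have := hg0 x
        simp only [f] at hx
        linarith
      exact Nat.lt_succ_iff.mp (by exact_mod_cast h1)
    · intro hx
      have h1 : (h x : ℝ) ≤ i := by exact_mod_cast hx
      have := hg1 x
      simp only [f]
      linarith
  have hinj : Function.Injective f := by
    intro x y hxy
    have h1 : h x ≤ h y := (hle x _).mp (hxy ▸ (hle y _).mpr le_rfl)
    have h2 : h y ≤ h x := (hle y _).mp (hxy ▸ (hle x _).mpr le_rfl)
    have h3 : h x = h y := le_antisymm h1 h2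
    have h4 : (g x : ℝ) = g y := by
      simp only [f, h3] at hxy
      linarith
    exact g.injective (Subtype.ext h4)
  obtain ⟨θ, hθ, hθf⟩ := exists_measurableEquiv_cdfUnit μ hf hinj
  refine ⟨θ, hθ, fun i => ?_⟩
  have hP : IsProbabilityMeasure (μ.map f) := Measure.isProbabilityMeasure_map hf.aemeasurable
  have hset : {x | h x ≤ i} = f ⁻¹' Set.Iic ((i : ℝ) + 1) := by
    ext x
    exact (hle x i).symm
  have hc : μ.real {x | h x ≤ i} = cdfUnit (μ.map f) (i + 1) := by
    rw [hset, cdfUnit]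
    simp only
    rw [ProbabilityTheory.cdf_eq_real, measureReal_def, measureReal_def,
      Measure.map_apply hf measurableSet_Iic]
  rw [hc]
  have hmeas : MeasurableSet {x | (θ x : ℝ) ≤ cdfUnit (μ.map f) (i + 1)} :=
    measurableSet_le (measurable_subtype_coe.comp θ.measurable) measurable_const
  -- One inclusion follows from monotonicity; the other is replaced by the equality of the two
  -- measures.
  refine ae_eq_of_ae_subset_of_measure_ge ?_ ?_ (measurableSet_le hh measurable_const).nullMeasurableSet
    (measure_ne_top _ _)
  · filter_upwards [hθf] with x hx hxi
    change (θ x : ℝ) ≤ _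
    rw [hx]
    exact monotone_cdfUnit _ ((hle x i).mpr hxi)
  · have : {x | (θ x : ℝ) ≤ cdfUnit (μ.map f) (i + 1)} =
        θ ⁻¹' Set.Iic (cdfUnit (μ.map f) (i + 1)) := rfl
    rw [this, hθ.measure_preimage measurableSet_Iic.nullMeasurableSet, unitInterval.volume_Iic,
      ← hc, measureReal_def, ENNReal.ofReal_toReal (measure_ne_top _ _)]

end Isomorphism

/-! ### Integrability of bounded kernels -/

section Integrability

variable {I J E : Type*} [MeasurableSpace I] [MeasurableSpace J] [NormedAddCommGroup E]
  {μ : Measure I} {ν : Measure J}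

theorem integrable_comp_prodMap [SFinite μ] [SFinite ν] {θ : I ≃ᵐ J}
    (hθ : MeasurePreserving θ μ ν) {w : J × J → E} (hw : Integrable w (ν.prod ν)) :
    Integrable (fun p : I × I => w (θ p.1, θ p.2)) (μ.prod μ) :=
  (hθ.prod hθ).integrable_comp_of_integrable hw

theorem integrable_of_ae_mem_isBounded [IsFiniteMeasure μ] {K : Set E}
    (hK : Bornology.IsBounded K) {w : I → E} (hw : AEStronglyMeasurable w μ)
    (hwK : ∀ᵐ p ∂μ, w p ∈ K) : Integrable w μ := by
  obtain ⟨C, hC⟩ := hK.exists_norm_le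
  exact .of_bound hw C (hwK.mono fun p hp => hC _ hp)

end Integrability

/-! ### Elementary properties of the cut norm -/

section CutNorm

variable {I J H : Type*} [MeasurableSpace I] [MeasurableSpace J]
  [NormedAddCommGroup H] [InnerProductSpace ℝ H] {μ : Measure I} {ν : Measure J}

theorem iSup_ofReal_inner_eq_enorm (x : H) :
    ⨆ (e : H) (_ : ‖e‖ ≤ 1), ENNReal.ofReal (inner ℝ e x) = ‖x‖ₑ := by
  apply le_antisymm
  · refine iSup₂_le fun e he => ?_
    rw [← ofReal_norm]
    refine ENNReal.ofReal_le_ofReal ((real_inner_le_norm e x).trans ?_)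
    exact mul_le_of_le_one_left (norm_nonneg x) he
  · rcases eq_or_ne x 0 with rfl | hx
    · simp
    refine le_iSup₂_of_le (‖x‖⁻¹ • x) ?_ ?_
    · rw [norm_smul, norm_inv, norm_norm, inv_mul_cancel₀ (norm_ne_zero_iff.mpr hx)]
    · rw [real_inner_smul_left, real_inner_self_eq_norm_sq, pow_two,
        inv_mul_cancel_left₀ (norm_ne_zero_iff.mpr hx), ofReal_norm]

/-- By duality the supremum over `e` gives the norm of the rectangle integral. This form serves for
norm estimates; the original one is kept for weak limits, which only see scalar pairings. -/
theorem cutNorm_eq_iSup_enorm (w : I × J → H) :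
    cutNorm μ ν w = ⨆ (S : Set I) (_ : MeasurableSet S) (T : Set J) (_ : MeasurableSet T),
      ‖∫ p in S ×ˢ T, w p ∂(μ.prod ν)‖ₑ := by
  apply le_antisymm
  · refine iSup₂_le fun e he => iSup₂_le fun S hS => iSup₂_le fun T hT => ?_
    refine le_iSup₂_of_le S hS (le_iSup₂_of_le T hT ?_)
    rw [← iSup_ofReal_inner_eq_enorm]
    exact le_iSup₂_of_le e he le_rfl
  · refine iSup₂_le fun S hS => iSup₂_le fun T hT => ?_
    rw [← iSup_ofReal_inner_eq_enorm]
    refine iSup₂_le fun e he => ?_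
    exact le_iSup₂_of_le e he (le_iSup₂_of_le S hS (le_iSup₂_of_le T hT le_rfl))

theorem enorm_setIntegral_le_cutNorm (w : I × J → H) {S : Set I} (hS : MeasurableSet S)
    {T : Set J} (hT : MeasurableSet T) :
    ‖∫ p in S ×ˢ T, w p ∂(μ.prod ν)‖ₑ ≤ cutNorm μ ν w := by
  rw [cutNorm_eq_iSup_enorm]
  exact le_iSup₂_of_le S hS (le_iSup₂_of_le T hT le_rfl)

theorem cutNorm_le {w : I × J → H} {c : ℝ≥0∞}
    (h : ∀ S T, MeasurableSet S → MeasurableSet T →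
      ‖∫ p in S ×ˢ T, w p ∂(μ.prod ν)‖ₑ ≤ c) : cutNorm μ ν w ≤ c := by
  rw [cutNorm_eq_iSup_enorm]
  exact iSup₂_le fun S hS => iSup₂_le fun T hT => h S T hS hT

theorem cutNorm_congr_ae {v w : I × J → H} (h : v =ᵐ[μ.prod ν] w) :
    cutNorm μ ν v = cutNorm μ ν w := by
  simp_rw [cutNorm_eq_iSup_enorm, integral_congr_ae (ae_restrict_of_ae h)]

theorem cutNorm_add_le {v w : I × J → H} (hv : Integrable v (μ.prod ν))
    (hw : Integrable w (μ.prod ν)) :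
    cutNorm μ ν (fun p => v p + w p) ≤ cutNorm μ ν v + cutNorm μ ν w := by
  refine cutNorm_le fun S T hS hT => ?_
  rw [integral_add hv.integrableOn hw.integrableOn]
  exact (enorm_add_le _ _).trans (add_le_add (enorm_setIntegral_le_cutNorm v hS hT)
    (enorm_setIntegral_le_cutNorm w hS hT))

theorem cutNorm_neg (w : I × J → H) : cutNorm μ ν (fun p => -w p) = cutNorm μ ν w := by
  simp_rw [cutNorm_eq_iSup_enorm, integral_neg, enorm_neg]

theorem cutNorm_sub_comm (v w : I × J → H) :
    cutNorm μ ν (fun p => v p - w p) = cutNorm μ ν (fun p => w p - v p) := by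
  rw [← cutNorm_neg]
  simp_rw [neg_sub]

theorem cutNorm_sub_le {u v w : I × J → H} (hu : Integrable u (μ.prod ν))
    (hv : Integrable v (μ.prod ν)) (hw : Integrable w (μ.prod ν)) :
    cutNorm μ ν (fun p => u p - w p) ≤
      cutNorm μ ν (fun p => u p - v p) + cutNorm μ ν (fun p => v p - w p) := by
  have h : cutNorm μ ν (fun p => (u p - v p) + (v p - w p)) ≤
      cutNorm μ ν (fun p => u p - v p) + cutNorm μ ν (fun p => v p - w p) :=
    cutNorm_add_le (hu.sub hv) (hv.sub hw)
  simpa only [sub_add_sub_cancel] using h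

theorem cutNorm_le_lintegral (w : I × J → H) :
    cutNorm μ ν w ≤ ∫⁻ p, ‖w p‖ₑ ∂(μ.prod ν) :=
  cutNorm_le fun _ _ _ _ =>
    (enorm_integral_le_lintegral_enorm _).trans (setLIntegral_le_lintegral _ _)

theorem cutNorm_le_of_ae_norm_le [IsProbabilityMeasure μ] [IsProbabilityMeasure ν]
    {w : I × J → H} {c : ℝ} (h : ∀ᵐ p ∂(μ.prod ν), ‖w p‖ ≤ c) :
    cutNorm μ ν w ≤ ENNReal.ofReal c := by
  refine (cutNorm_le_lintegral w).trans ?_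
  calc ∫⁻ p, ‖w p‖ₑ ∂(μ.prod ν) ≤ ∫⁻ _, ENNReal.ofReal c ∂(μ.prod ν) := by
        refine lintegral_mono_ae (h.mono fun p hp => ?_)
        rw [← ofReal_norm]
        exact ENNReal.ofReal_le_ofReal hp
    _ = ENNReal.ofReal c := by simp

theorem cutNorm_comp [SFinite μ] [SFinite ν] (θ : I ≃ᵐ J) (hθ : MeasurePreserving θ μ ν)
    (w : J × J → H) :
    cutNorm μ μ (fun p => w (θ p.1, θ p.2)) = cutNorm ν ν w := by
  have hE : MeasurePreserving (θ.prodCongr θ) (μ.prod μ) (ν.prod ν) := hθ.prod hθ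
  have key : ∀ S T : Set J, ∫ p in (θ ⁻¹' S) ×ˢ (θ ⁻¹' T), w (θ p.1, θ p.2) ∂(μ.prod μ) =
      ∫ p in S ×ˢ T, w p ∂(ν.prod ν) := fun S T =>
    hE.setIntegral_preimage_emb (θ.prodCongr θ).measurableEmbedding w (S ×ˢ T)
  apply le_antisymm
  · refine cutNorm_le fun S T hS hT => ?_
    have h1 : ∀ S : Set I, θ ⁻¹' (θ.symm ⁻¹' S) = S := fun S => by ext x; simp
    rw [← h1 S, ← h1 T, key]
    exact enorm_setIntegral_le_cutNorm w (θ.symm.measurable hS) (θ.symm.measurable hT)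
  · refine cutNorm_le fun S T hS hT => ?_
    rw [← key]
    exact enorm_setIntegral_le_cutNorm (fun p : I × I => w (θ p.1, θ p.2))
      (θ.measurable hS) (θ.measurable hT)

end CutNorm

/-! ### The cut distance as a pseudometric -/

section CutDist

variable {I J L H : Type*} [MeasurableSpace I] [MeasurableSpace J] [MeasurableSpace L]
  [NormedAddCommGroup H] [InnerProductSpace ℝ H] {μ : Measure I} {ν : Measure J} {ρ : Measure L}

theorem cutDist_le_cutNorm (θ : I ≃ᵐ J) (hθ : MeasurePreserving θ μ ν) (w₁ : I × I → H)
    (w₂ : J × J → H) :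
    cutDist μ ν w₁ w₂ ≤ cutNorm μ μ (fun p => w₁ p - w₂ (θ p.1, θ p.2)) :=
  iInf_le_of_le θ (iInf₂_le_of_le θ.bijective hθ le_rfl)

/-- A measurable bijection of standard Borel spaces has a measurable inverse, so near-optimal maps
can be inverted and composed. Symmetry and the triangle inequality rest on this. -/
theorem exists_cutNorm_lt [StandardBorelSpace I] [StandardBorelSpace J] {w₁ : I × I → H}
    {w₂ : J × J → H} {c : ℝ≥0∞} (h : cutDist μ ν w₁ w₂ < c) :
    ∃ θ : I ≃ᵐ J, MeasurePreserving θ μ ν ∧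
      cutNorm μ μ (fun p => w₁ p - w₂ (θ p.1, θ p.2)) < c := by
  simp only [cutDist, iInf_lt_iff] at h
  obtain ⟨Φ, hΦ, hm, hlt⟩ := h
  obtain ⟨θ, rfl⟩ := exists_measurableEquiv_of_bijective hΦ hm.measurable
  exact ⟨θ, hm, hlt⟩

theorem cutDist_self (w : I × I → H) : cutDist μ μ w w = 0 :=
  le_antisymm ((cutDist_le_cutNorm (MeasurableEquiv.refl I) (.id μ) w w).trans
    (by simp [cutNorm_eq_iSup_enorm])) zero_le

theorem cutNorm_comp_symm [SFinite μ] [SFinite ν] {θ : I ≃ᵐ J} (hθ : MeasurePreserving θ μ ν)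
    (w₁ : I × I → H) (w₂ : J × J → H) :
    cutNorm ν ν (fun p => w₁ (θ.symm p.1, θ.symm p.2) - w₂ p) =
      cutNorm μ μ (fun p => w₁ p - w₂ (θ p.1, θ p.2)) := by
  rw [← cutNorm_comp θ hθ]
  simp

theorem cutDist_comm_le [StandardBorelSpace I] [StandardBorelSpace J] [SFinite μ] [SFinite ν]
    (w₁ : I × I → H) (w₂ : J × J → H) : cutDist ν μ w₂ w₁ ≤ cutDist μ ν w₁ w₂ := by
  refine le_of_forall_gt_imp_ge_of_dense fun c hc => ?_
  obtain ⟨θ, hθ, hlt⟩ := exists_cutNorm_lt hc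
  refine (cutDist_le_cutNorm θ.symm hθ.symm w₂ w₁).trans ?_
  rw [cutNorm_sub_comm, cutNorm_comp_symm hθ]
  exact hlt.le

theorem cutDist_triangle [StandardBorelSpace I] [StandardBorelSpace J] [StandardBorelSpace L]
    [SFinite μ] [SFinite ν] [SFinite ρ] {w₁ : I × I → H} {w₂ : J × J → H} {w₃ : L × L → H}
    (h₁ : Integrable w₁ (μ.prod μ)) (h₂ : Integrable w₂ (ν.prod ν))
    (h₃ : Integrable w₃ (ρ.prod ρ)) :
    cutDist μ ρ w₁ w₃ ≤ cutDist μ ν w₁ w₂ + cutDist ν ρ w₂ w₃ := by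
  refine ENNReal.le_of_forall_pos_le_add fun ε hε htop => ?_
  have hε2 : (ε / 2 : ℝ≥0∞) ≠ 0 := by simp [hε.ne']
  obtain ⟨θ, hθ, hlt⟩ := exists_cutNorm_lt
    (ENNReal.lt_add_right (ENNReal.add_lt_top.mp htop).1.ne hε2)
  obtain ⟨η, hη, hlt'⟩ := exists_cutNorm_lt
    (ENNReal.lt_add_right (ENNReal.add_lt_top.mp htop).2.ne hε2)
  refine (cutDist_le_cutNorm (θ.trans η) (hη.comp hθ) w₁ w₃).trans ?_
  refine (cutNorm_sub_le h₁ (integrable_comp_prodMap hθ h₂)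
    (integrable_comp_prodMap hθ (integrable_comp_prodMap hη h₃))).trans ?_
  have h4 := cutNorm_comp θ hθ (fun p => w₂ p - w₃ (η p.1, η p.2))
  calc _ ≤ (cutDist μ ν w₁ w₂ + ε / 2) + (cutDist ν ρ w₂ w₃ + ε / 2) :=
        add_le_add hlt.le (h4.trans_le hlt'.le)
    _ = _ := by rw [add_add_add_comm, ENNReal.add_halves]

/-- The kernels on `J × J` with values in a compact set `K`. -/
structure KernelsIn (ν : Measure J) (K : TopologicalSpace.Compacts H) where
  /-- the underlying function -/
  toFun : J × J → H
  prop : AEStronglyMeasurable toFun (ν.prod ν) ∧ ∀ᵐ p ∂(ν.prod ν), toFun p ∈ K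

theorem KernelsIn.integrable {E : Type*} [NormedAddCommGroup E] [IsFiniteMeasure ν]
    {K : TopologicalSpace.Compacts E}
    (w : KernelsIn ν K) : Integrable w.1 (ν.prod ν) :=
  integrable_of_ae_mem_isBounded K.isCompact.isBounded w.2.1 w.2.2

instance [StandardBorelSpace J] [IsFiniteMeasure ν] (K : TopologicalSpace.Compacts H) :
    PseudoEMetricSpace (KernelsIn ν K) where
  edist v w := cutDist ν ν v.1 w.1
  edist_self w := cutDist_self w.1
  edist_comm _ _ := le_antisymm (cutDist_comm_le _ _) (cutDist_comm_le _ _)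
  edist_triangle u v w := cutDist_triangle u.integrable v.integrable w.integrable

theorem KernelsIn.edist_def [StandardBorelSpace J] [IsFiniteMeasure ν]
    {K : TopologicalSpace.Compacts H} (v w : KernelsIn ν K) :
    edist v w = cutDist ν ν v.1 w.1 := rfl

end CutDist

/-! ### Weak limits of functions with values in a compact convex set -/

section WeakLimit

/-- If all averages of an integrable function lie in a closed set, so do almost all values. -/
theorem ae_mem_of_forall_setAverage_mem {Ω E : Type*} [MeasurableSpace Ω] [NormedAddCommGroup E]
    [NormedSpace ℝ E] [CompleteSpace E] {P : Measure Ω} [IsFiniteMeasure P] {K : Set E}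
    (hK : IsClosed K) {f : Ω → E} (hf : Integrable f P)
    (h : ∀ A, MeasurableSet A → P A ≠ 0 → ⨍ p in A, f p ∂P ∈ K) : ∀ᵐ p ∂P, f p ∈ K := by
  borelize E
  obtain ⟨g, hg, hfg⟩ := hf.aestronglyMeasurable
  have hgi : Integrable g P := hf.congr hfg
  suffices hgK : ∀ᵐ p ∂P, g p ∈ K by
    filter_upwards [hgK, hfg] with p hp hpg
    rwa [hpg]
  obtain ⟨c, hc, hcl⟩ := hg.isSeparable_range
  -- The complement of `K` within the range of `g` is covered by countably many closed balls
  -- disjoint from `K`. If `g` were in such a ball with positive probability, its average there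
  -- would lie both in the ball, by convexity, and in `K`.
  let T : Set (E × ℚ) := {z | z.1 ∈ c ∧ Disjoint (Metric.closedBall z.1 z.2) K}
  have hT : T.Countable := (hc.prod (Set.countable_univ (α := ℚ))).mono
    fun z (hz : z.1 ∈ c ∧ _) => Set.mem_prod.mpr ⟨hz.1, Set.mem_univ _⟩
  have hnull : ∀ z ∈ T, P (g ⁻¹' Metric.closedBall z.1 z.2) = 0 := by
    intro z hz
    by_contra hne
    have hA : MeasurableSet (g ⁻¹' Metric.closedBall z.1 z.2) :=
      hg.measurable Metric.isClosed_closedBall.measurableSet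
    have h1 : ⨍ p in g ⁻¹' Metric.closedBall z.1 z.2, g p ∂P ∈ Metric.closedBall z.1 (z.2 : ℝ) :=
      (convex_closedBall z.1 (z.2 : ℝ)).set_average_mem Metric.isClosed_closedBall hne
        (measure_ne_top _ _) (ae_restrict_mem hA) hgi.integrableOn
    have h2 := h _ hA hne
    rw [setAverage_congr_fun hA (hfg.mono fun p hp _ => hp)] at h2
    exact Set.disjoint_left.mp hz.2 h1 h2
  refine measure_mono_null (fun p hp => ?_) ((measure_biUnion_null_iff hT).mpr hnull)
  have hp : g p ∈ Kᶜ := hp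
  obtain ⟨ε, hε, hball⟩ := Metric.isOpen_iff.mp hK.isOpen_compl _ hp
  obtain ⟨y, hy, hyd⟩ := Metric.mem_closure_iff.mp (hcl ⟨p, rfl⟩) (ε / 2) (half_pos hε)
  obtain ⟨q, hq1, hq2⟩ := exists_rat_btwn hyd
  refine Set.mem_biUnion (x := (y, q)) ⟨hy, ?_⟩ hq1.le
  refine Set.disjoint_left.mpr fun z hz hzK => hball ?_ hzK
  have hz' : dist z y ≤ q := hz
  rw [Metric.mem_ball]
  have := dist_triangle z y (g p)
  rw [dist_comm y] at this
  linarith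

variable {Ω H : Type*} [MeasurableSpace Ω] {P : Measure Ω}
  [NormedAddCommGroup H] [InnerProductSpace ℝ H] [CompleteSpace H]

/-- Every bounded sequence in a Hilbert space has a weak limit along an ultrafilter. -/
theorem exists_weak_limit_hilbert (x : ℕ → H) {R : ℝ} (hx : ∀ m, ‖x m‖ ≤ R) (𝓤 : Ultrafilter ℕ) :
    ∃ y : H, ∀ g : H, Tendsto (fun m => inner ℝ g (x m)) 𝓤 (𝓝 (inner ℝ g y)) := by
  let F : ℕ → WeakDual ℝ H := fun m => StrongDual.toWeakDual (InnerProductSpace.toDual ℝ H (x m))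
  have hF : ∀ m, F m ∈ WeakDual.toStrongDual ⁻¹' Metric.closedBall (0 : StrongDual ℝ H) R := by
    intro m
    rw [Set.mem_preimage, mem_closedBall_zero_iff]
    exact ((InnerProductSpace.toDual ℝ H).norm_map (x m)).trans_le (hx m)
  obtain ⟨f, -, hf⟩ := isCompact_iff_ultrafilter_le_nhds'.mp
    (WeakDual.isCompact_closedBall (0 : StrongDual ℝ H) R) (𝓤.map F)
    (Eventually.of_forall (f := (𝓤 : Filter ℕ)) hF)
  refine ⟨(InnerProductSpace.toDual ℝ H).symm (WeakDual.toStrongDual f), fun g => ?_⟩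
  have h1 : Tendsto (fun m => F m g) 𝓤 (𝓝 (f g)) :=
    ((WeakDual.eval_continuous g).tendsto f).comp hf
  have h2 : inner ℝ g ((InnerProductSpace.toDual ℝ H).symm (WeakDual.toStrongDual f)) = f g := by
    rw [real_inner_comm, InnerProductSpace.toDual_symm_apply]
    rfl
  rw [h2]
  refine h1.congr fun m => ?_
  rw [real_inner_comm]
  rfl

theorem memLp_of_ae_mem_isBounded {E : Type*} [NormedAddCommGroup E] [IsFiniteMeasure P]
    {K : Set E} (hK : Bornology.IsBounded K) {w : Ω → E} (hw : AEStronglyMeasurable w P)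
    (hwK : ∀ᵐ p ∂P, w p ∈ K) (q : ℝ≥0∞) : MemLp w q P := by
  obtain ⟨C, hC⟩ := hK.exists_norm_le
  exact .of_bound hw C (hwK.mono fun p hp => hC _ hp)

/-- Boundedness in L² gives the weak limit. Its averages over sets of positive measure are weak
limits of averages that lie in `K` by convexity, hence lie in `K` by compactness, and this forces
almost all values into `K`. -/
theorem exists_weak_limit [IsFiniteMeasure P] {K : Set H} (hK : IsCompact K)
    (hconv : Convex ℝ K) {w : ℕ → Ω → H} (hw : ∀ m, AEStronglyMeasurable (w m) P)
    (hwK : ∀ m, ∀ᵐ p ∂P, w m p ∈ K) (𝓤 : Ultrafilter ℕ) :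
    ∃ u : Ω → H, AEStronglyMeasurable u P ∧ (∀ᵐ p ∂P, u p ∈ K) ∧
      ∀ g : Ω → H, MemLp g 2 P →
        Tendsto (fun m => ∫ p, inner ℝ (g p) (w m p) ∂P) 𝓤 (𝓝 (∫ p, inner ℝ (g p) (u p) ∂P)) := by
  have hmem : ∀ m, MemLp (w m) 2 P := fun m =>
    memLp_of_ae_mem_isBounded hK.isBounded (hw m) (hwK m) 2
  obtain ⟨C, hC⟩ := hK.isBounded.exists_norm_le
  have hbound : ∀ m, ‖(hmem m).toLp (w m)‖ ≤
      P.real Set.univ ^ (2 : ℝ≥0∞).toReal⁻¹ * max C 0 := by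
    intro m
    refine Lp.norm_le_of_ae_bound (le_max_right _ _) ?_
    filter_upwards [(hmem m).coeFn_toLp, hwK m] with p hp hpK
    rw [hp]
    exact (hC _ hpK).trans (le_max_left _ _)
  obtain ⟨y, hy⟩ := exists_weak_limit_hilbert _ hbound 𝓤
  have hlim : ∀ g : Ω → H, MemLp g 2 P →
      Tendsto (fun m => ∫ p, inner ℝ (g p) (w m p) ∂P) 𝓤 (𝓝 (∫ p, inner ℝ (g p) (y p) ∂P)) := by
    intro g hg
    have h1 := hy (hg.toLp g)
    simp only [L2.inner_def] at h1
    convert! h1 using 1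
    · funext m
      refine integral_congr_ae ?_
      filter_upwards [(hmem m).coeFn_toLp, hg.coeFn_toLp] with p hp hpg
      rw [hp, hpg]
    · congr 1
      refine integral_congr_ae ?_
      filter_upwards [hg.coeFn_toLp] with p hpg
      rw [hpg]
  have hyi : Integrable (fun p => y p) P := (Lp.memLp y).integrable (by norm_num)
  refine ⟨y, Lp.aestronglyMeasurable y, ?_, hlim⟩
  refine ae_mem_of_forall_setAverage_mem hK.isClosed hyi fun A hA hA0 => ?_
  have havg : ∀ m, ⨍ p in A, w m p ∂P ∈ K := fun m =>
    hconv.set_average_mem hK.isClosed hA0 (measure_ne_top _ _) (ae_restrict_of_ae (hwK m))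
      (integrable_of_ae_mem_isBounded hK.isBounded (hw m) (hwK m)).integrableOn
  -- The averages converge in norm along the ultrafilter, by compactness; testing against each `e`
  -- identifies their limit with the average of the weak limit.
  obtain ⟨z, hzK, hz⟩ := isCompact_iff_ultrafilter_le_nhds'.mp hK
    (𝓤.map fun m => ⨍ p in A, w m p ∂P) (Eventually.of_forall (f := (𝓤 : Filter ℕ)) havg)
  have hin : ∀ (e : H) (v : Ω → H), Integrable v P → inner ℝ e (⨍ p in A, v p ∂P) =
      ∫ p, inner ℝ (A.indicator (fun _ => (P.real A)⁻¹ • e) p) (v p) ∂P := by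
    intro e v hv
    rw [setAverage_eq, inner_smul_right, ← integral_inner hv.integrableOn,
      ← integral_indicator hA, ← integral_const_mul]
    refine integral_congr_ae (Eventually.of_forall fun p => ?_)
    by_cases hp : p ∈ A <;> simp [hp, real_inner_smul_left]
  have hzy : z = ⨍ p in A, y p ∂P := by
    refine ext_inner_left ℝ fun e => ?_
    have h1 : Tendsto (fun m => inner ℝ e (⨍ p in A, w m p ∂P)) 𝓤 (𝓝 (inner ℝ e z)) :=
      tendsto_const_nhds.inner hz
    refine tendsto_nhds_unique h1 ?_
    rw [hin e _ hyi]
    refine (hlim _ ((memLp_const _).indicator hA)).congr fun m => ?_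
    rw [hin e _ ((hmem m).integrable (by norm_num))]
  exact hzy ▸ hzK

theorem tendsto_inner_setIntegral_of_weak [IsFiniteMeasure P] {w : ℕ → Ω → H} {u : Ω → H}
    {l : Filter ℕ} (hw : ∀ m, Integrable (w m) P) (hu : Integrable u P)
    (h : ∀ g : Ω → H, MemLp g 2 P →
        Tendsto (fun m => ∫ p, inner ℝ (g p) (w m p) ∂P) l (𝓝 (∫ p, inner ℝ (g p) (u p) ∂P)))
    {A : Set Ω} (hA : MeasurableSet A) (e : H) :
    Tendsto (fun m => inner ℝ e (∫ p in A, w m p ∂P)) l (𝓝 (inner ℝ e (∫ p in A, u p ∂P))) := by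
  have hin : ∀ v : Ω → H, Integrable v P → inner ℝ e (∫ p in A, v p ∂P) =
      ∫ p, inner ℝ (A.indicator (fun _ => e) p) (v p) ∂P := by
    intro v hv
    rw [← integral_inner hv.integrableOn, ← integral_indicator hA]
    refine integral_congr_ae (Eventually.of_forall fun p => ?_)
    by_cases hp : p ∈ A <;> simp [hp]
  rw [hin u hu]
  refine (h _ ((memLp_const e).indicator hA)).congr fun m => ?_
  rw [hin _ (hw m)]

end WeakLimit

/-! ### Completeness for the cut distance -/

section Completeness

variable {J H : Type*} [MeasurableSpace J] [NormedAddCommGroup H] [InnerProductSpace ℝ H]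
  {ν : Measure J}

theorem ofReal_inner_setIntegral_le_cutNorm {I : Type*} [MeasurableSpace I] {μ : Measure I}
    (w : I × J → H) {e : H} (he : ‖e‖ ≤ 1) {S : Set I} (hS : MeasurableSet S) {T : Set J}
    (hT : MeasurableSet T) :
    ENNReal.ofReal (inner ℝ e (∫ p in S ×ˢ T, w p ∂(μ.prod ν))) ≤ cutNorm μ ν w :=
  le_iSup₂_of_le e he (le_iSup₂_of_le S hS (le_iSup₂_of_le T hT le_rfl))

/-- The cut norm is lower semicontinuous for weak convergence. -/
theorem cutNorm_sub_le_of_weak [IsFiniteMeasure ν] [CompleteSpace H] {v : J × J → H}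
    {w : ℕ → J × J → H} {u : J × J → H} {l : Filter ℕ} [l.NeBot]
    (hv : Integrable v (ν.prod ν)) (hw : ∀ m, Integrable (w m) (ν.prod ν))
    (hu : Integrable u (ν.prod ν))
    (h : ∀ g : J × J → H, MemLp g 2 (ν.prod ν) →
        Tendsto (fun m => ∫ p, inner ℝ (g p) (w m p) ∂(ν.prod ν)) l
          (𝓝 (∫ p, inner ℝ (g p) (u p) ∂(ν.prod ν))))
    {c : ℝ≥0∞} (hc : ∀ᶠ m in l, cutNorm ν ν (fun p => v p - w m p) ≤ c) :
    cutNorm ν ν (fun p => v p - u p) ≤ c := by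
  refine iSup₂_le fun e he => iSup₂_le fun S hS => iSup₂_le fun T hT => ?_
  have ht : Tendsto (fun m => ENNReal.ofReal
      (inner ℝ e (∫ p in S ×ˢ T, (v p - w m p) ∂(ν.prod ν)))) l
      (𝓝 (ENNReal.ofReal (inner ℝ e (∫ p in S ×ˢ T, (v p - u p) ∂(ν.prod ν))))) := by
    refine ENNReal.tendsto_ofReal ?_
    simp_rw [integral_sub hv.integrableOn (hw _).integrableOn,
      integral_sub hv.integrableOn hu.integrableOn, inner_sub_right]
    exact (tendsto_inner_setIntegral_of_weak hw hu h (hS.prod hT) e).const_sub _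
  exact le_of_tendsto ht (hc.mono fun m hm =>
    (ofReal_inner_setIntegral_le_cutNorm _ he hS hT).trans hm)

/-- Keeping the tail of the geometric series on the left makes the induction close: each step spends
exactly the difference of two consecutive tails. -/
theorem cutNorm_sub_add_geometric [IsFiniteMeasure ν] {v : ℕ → J × J → H}
    (hv : ∀ n, Integrable (v n) (ν.prod ν))
    (h : ∀ n, cutNorm ν ν (fun p => v n p - v (n + 1) p) ≤ 2⁻¹ ^ n) (n k : ℕ) :
    cutNorm ν ν (fun p => v n p - v (n + k) p) + 2 * 2⁻¹ ^ (n + k) ≤ 2 * 2⁻¹ ^ n := by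
  induction k with
  | zero => simp [cutNorm_eq_iSup_enorm]
  | succ k ih =>
    refine le_trans ?_ ih
    have h1 : (2 : ℝ≥0∞) * 2⁻¹ ^ (n + (k + 1)) = 2⁻¹ ^ (n + k) := by
      rw [← add_assoc, pow_succ', ← mul_assoc, ENNReal.mul_inv_cancel (by simp) (by simp), one_mul]
    rw [h1, two_mul]
    exact (add_le_add ((cutNorm_sub_le (hv n) (hv (n + k)) (hv (n + (k + 1)))).trans
      (add_le_add le_rfl (h (n + k)))) le_rfl).trans_eq (add_assoc _ _ _)

theorem completeSpace_kernelsIn [StandardBorelSpace J] [IsFiniteMeasure ν] [CompleteSpace H]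
    (K : TopologicalSpace.Compacts H) (hconv : Convex ℝ (K : Set H)) :
    CompleteSpace (KernelsIn ν K) := by
  refine EMetric.complete_of_convergent_controlled_sequences (fun n => 2⁻¹ ^ n)
    (fun n => ENNReal.pow_pos (by simp) n) fun u hu => ?_
  have step : ∀ n, ∃ θ : J ≃ᵐ J, MeasurePreserving θ ν ν ∧
      cutNorm ν ν (fun p => (u n).1 p - (u (n + 1)).1 (θ p.1, θ p.2)) < 2⁻¹ ^ n := fun n =>
    exists_cutNorm_lt (hu n n (n + 1) le_rfl n.le_succ)
  choose θ hθ hlt using step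
  -- The near-optimal isomorphisms are accumulated, so that consecutive terms of `v` are close in
  -- cut norm itself and no longer only after a rearrangement.
  let Ψ : ℕ → J ≃ᵐ J := fun n => Nat.rec (MeasurableEquiv.refl J) (fun n e => e.trans (θ n)) n
  have hΨ : ∀ n, MeasurePreserving (Ψ n) ν ν := by
    intro n
    induction n with
    | zero => exact .id ν
    | succ n ih => exact (hθ n).comp ih
  let v : ℕ → J × J → H := fun n p => (u n).1 (Ψ n p.1, Ψ n p.2)
  have hvm : ∀ n, AEStronglyMeasurable (v n) (ν.prod ν) := fun n =>
    (u n).2.1.comp_measurePreserving ((hΨ n).prod (hΨ n))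
  have hvK : ∀ n, ∀ᵐ p ∂(ν.prod ν), v n p ∈ (K : Set H) := fun n =>
    ((hΨ n).prod (hΨ n)).quasiMeasurePreserving.ae (u n).2.2
  have hvi : ∀ n, Integrable (v n) (ν.prod ν) := fun n =>
    integrable_of_ae_mem_isBounded K.isCompact.isBounded (hvm n) (hvK n)
  have hv1 : ∀ n, cutNorm ν ν (fun p => v n p - v (n + 1) p) ≤ 2⁻¹ ^ n := fun n =>
    ((cutNorm_comp (Ψ n) (hΨ n) _).trans_lt (hlt n)).le
  obtain ⟨w, hwm, hwK, hw⟩ := exists_weak_limit K.isCompact hconv hvm hvK (hyperfilter ℕ)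
  have hwi := integrable_of_ae_mem_isBounded K.isCompact.isBounded hwm hwK
  have hvw : ∀ n, cutNorm ν ν (fun p => v n p - w p) ≤ 2 * 2⁻¹ ^ n := fun n => by
    refine cutNorm_sub_le_of_weak (hvi n) hvi hwi hw ?_
    filter_upwards [Nat.hyperfilter_le_atTop (eventually_ge_atTop n)] with m hm
    obtain ⟨k, rfl⟩ := Nat.exists_eq_add_of_le hm
    exact le_self_add.trans (cutNorm_sub_add_geometric hvi hv1 n k)
  refine ⟨⟨w, hwm, hwK⟩, ?_⟩
  rw [tendsto_iff_edist_tendsto_0]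
  have h0 : Tendsto (fun n : ℕ => (2 : ℝ≥0∞) * 2⁻¹ ^ n) atTop (𝓝 0) := by
    have := ENNReal.Tendsto.const_mul (a := 2)
      (ENNReal.tendsto_pow_atTop_nhds_zero_of_lt_one (r := 2⁻¹) (by simp)) (Or.inr (by simp))
    simpa using this
  refine tendsto_of_tendsto_of_tendsto_of_le_of_le tendsto_const_nhds h0 (fun _ => zero_le)
    fun n => ?_
  refine le_trans ?_ (hvw n)
  rw [edist_comm, KernelsIn.edist_def]
  refine (cutDist_le_cutNorm (Ψ n) (hΨ n) _ _).trans ?_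
  rw [cutNorm_sub_comm]

end Completeness

/-! ### Weak regularity by greedy approximation -/

section Regularity

/-- Greedy approximation: a vector of the unit ball of a Hilbert space is, up to a vector that is
almost orthogonal to a given bounded set, a short linear combination of elements of this set. -/
theorem exists_greedy_approx {E : Type*} [NormedAddCommGroup E] [InnerProductSpace ℝ E] {x : E}
    (hx : ‖x‖ ≤ 1) {s : Set E} (hs : s.Nonempty) (hs1 : ∀ f ∈ s, ‖f‖ ≤ 1) {ε : ℝ} (hε : 0 < ε)
    (k : ℕ) :
    ∃ (a : Fin k → ℝ) (f : Fin k → E), (∀ i, |a i| ≤ 1) ∧ (∀ i, f i ∈ s) ∧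
      ((∀ g ∈ s, |inner ℝ g (x - ∑ i, a i • f i)| ≤ ε) ∨
        ‖x - ∑ i, a i • f i‖ ^ 2 ≤ 1 - k * ε ^ 2) := by
  induction k with
  | zero =>
    refine ⟨Fin.elim0, Fin.elim0, fun i => i.elim0, fun i => i.elim0, Or.inr ?_⟩
    simpa using hx
  | succ k ih =>
    obtain ⟨a, f, ha, hf, h⟩ := ih
    set r := x - ∑ i, a i • f i with hr
    have hsum : ∀ (c : ℝ) (g : E), x - ∑ i, (Fin.cons c a : Fin (k + 1) → ℝ) i •
        (Fin.cons g f : Fin (k + 1) → E) i = r - c • g := by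
      intro c g
      rw [Fin.sum_univ_succ]
      simp only [Fin.cons_zero, Fin.cons_succ, hr]
      abel
    have hmem : ∀ g ∈ s, ∀ i, (Fin.cons g f : Fin (k + 1) → E) i ∈ s := fun g hg i =>
      Fin.cases hg hf i
    have hcoef : ∀ c : ℝ, |c| ≤ 1 → ∀ i, |(Fin.cons c a : Fin (k + 1) → ℝ) i| ≤ 1 := fun c hc i =>
      Fin.cases (by simpa using hc) (fun j => by simpa using ha j) i
    by_cases hgood : ∀ g ∈ s, |inner ℝ g r| ≤ ε
    · obtain ⟨g, hg⟩ := hs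
      -- Once the residual is almost orthogonal to the set, the combination is padded with a zero
      -- coefficient to keep its length equal to the index.
      refine ⟨Fin.cons 0 a, Fin.cons g f, hcoef 0 (by simp), hmem g hg, Or.inl ?_⟩
      rw [hsum, zero_smul, sub_zero]
      exact hgood
    · have h2 := h.resolve_left hgood
      push Not at hgood
      obtain ⟨g, hg, hgε⟩ := hgood
      have hr1 : ‖r‖ ≤ 1 := by
        have : ‖r‖ ^ 2 ≤ 1 := h2.trans (sub_le_self _ (by positivity))
        exact (sq_le_one_iff₀ (norm_nonneg r)).mp this
      have hc1 : |inner ℝ g r| ≤ 1 := (abs_real_inner_le_norm g r).trans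
        (mul_le_one₀ (hs1 g hg) (norm_nonneg _) hr1)
      -- With coefficient `c = ⟪g, r⟫` and `‖g‖ ≤ 1`, the squared norm of the residual drops by at
      -- least `c ^ 2`, hence by at least `ε ^ 2`.
      refine ⟨Fin.cons (inner ℝ g r) a, Fin.cons g f, hcoef _ hc1, hmem g hg, Or.inr ?_⟩
      rw [hsum, norm_sub_sq_real, real_inner_smul_right, norm_smul, Real.norm_eq_abs, mul_pow,
        sq_abs, real_inner_comm g r]
      have hg2 : ‖g‖ ^ 2 ≤ 1 := pow_le_one₀ (norm_nonneg g) (hs1 g hg)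
      have h3 : ε ^ 2 ≤ inner ℝ g r ^ 2 := by
        rw [← sq_abs (inner ℝ g r)]
        exact pow_le_pow_left₀ hε.le hgε.le 2
      have h4 := mul_le_of_le_one_right (sq_nonneg (inner ℝ g r)) hg2
      push_cast
      linarith

variable {J H : Type*} [MeasurableSpace J] {ν : Measure J} [IsProbabilityMeasure ν]

/-- Weak regularity: a measurable set in the square is, up to a small error in cut norm, a
linear combination of boundedly many rectangles. -/
theorem exists_rectangle_approx {ε : ℝ} (hε : 0 < ε) : ∃ n : ℕ, ∀ (A : Set (J × J)),
    MeasurableSet A → ∃ (a : Fin n → ℝ) (S T : Fin n → Set J), (∀ i, |a i| ≤ 1) ∧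
      (∀ i, MeasurableSet (S i)) ∧ (∀ i, MeasurableSet (T i)) ∧
      cutNorm ν ν (fun p => A.indicator (1 : J × J → ℝ) p -
        ∑ i, a i * (S i ×ˢ T i).indicator (1 : J × J → ℝ) p) ≤ ENNReal.ofReal ε := by
  -- After more than `1 / ε ^ 2` steps the energy alternative would make a square negative, so the
  -- residual is almost orthogonal to all rectangles. The bound does not depend on `A`.
  obtain ⟨n, hn⟩ := exists_nat_gt (1 / ε ^ 2)
  refine ⟨n, fun A hA => ?_⟩
  let s : Set (Lp ℝ 2 (ν.prod ν)) := {f | ∃ (S T : Set J) (hS : MeasurableSet S)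
    (hT : MeasurableSet T), f = indicatorConstLp 2 (hS.prod hT) (measure_ne_top _ _) (1 : ℝ)}
  have hnorm : ∀ B (hB : MeasurableSet B),
      ‖indicatorConstLp 2 hB (measure_ne_top (ν.prod ν) _) (1 : ℝ)‖ ≤ 1 := by
    intro B hB
    rw [norm_indicatorConstLp (by norm_num) (by norm_num), norm_one, one_mul]
    exact Real.rpow_le_one measureReal_nonneg measureReal_le_one (by norm_num)
  obtain ⟨a, f, ha, hf, h⟩ := exists_greedy_approx (hnorm A hA) (s := s)
    ⟨_, ∅, ∅, .empty, .empty, rfl⟩ (by rintro _ ⟨S, T, hS, hT, rfl⟩; exact hnorm _ _) hε n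
  choose S T hS hT hfST using hf
  refine ⟨a, S, T, ha, hS, hT, cutNorm_le fun S' T' hS' hT' => ?_⟩
  have h1 : ∀ g ∈ s, |inner ℝ g (indicatorConstLp 2 hA (measure_ne_top (ν.prod ν) _) (1 : ℝ) -
      ∑ i, a i • f i)| ≤ ε := by
    refine h.resolve_right fun hneg => ?_
    have hn' : 1 < n * ε ^ 2 := (div_lt_iff₀ (by positivity)).mp hn
    have := hneg.trans_lt (sub_neg_of_lt hn')
    exact absurd this (not_lt.mpr (sq_nonneg _))
  -- The inner product of the residual with a rectangle is its integral over the rectangle, which is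
  -- what the cut norm measures.
  have h2 := h1 _ ⟨S', T', hS', hT', rfl⟩
  rw [inner_sub_right, inner_sum] at h2
  simp_rw [inner_smul_right, hfST, L2.real_inner_indicatorConstLp_one_indicatorConstLp_one] at h2
  rw [← ofReal_norm]
  refine ENNReal.ofReal_le_ofReal (le_of_eq_of_le ?_ h2)
  have hind : ∀ B : Set (J × J), MeasurableSet B →
      Integrable (B.indicator (1 : J × J → ℝ)) ((ν.prod ν).restrict (S' ×ˢ T')) := fun B hB =>
    (integrable_const (1 : ℝ)).indicator hB
  have hval : ∀ B : Set (J × J), MeasurableSet B →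
      ∫ p in S' ×ˢ T', B.indicator (1 : J × J → ℝ) p ∂(ν.prod ν) =
        (ν.prod ν).real (S' ×ˢ T' ∩ B) := by
    intro B hB
    rw [integral_indicator_one hB, measureReal_restrict_apply hB, Set.inter_comm]
  rw [integral_sub (hind A hA) (integrable_finsetSum _ fun i _ =>
    (hind _ ((hS i).prod (hT i))).const_mul _), integral_finsetSum _ fun i _ =>
    (hind _ ((hS i).prod (hT i))).const_mul _, hval A hA, Real.norm_eq_abs]
  simp_rw [integral_const_mul, hval _ ((hS _).prod (hT _))]

end Regularity

/-! ### Matching partitions with similar masses -/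

section Rearrangement

variable {J : Type*} [MeasurableSpace J] [StandardBorelSpace J] {ν : Measure J}
  [IsProbabilityMeasure ν] [NullSingletonClass ν]

open scoped symmDiff in
/-- Two finite measurable partitions with almost the same masses can be almost matched by an
isomorphism of an atomless standard probability space. -/
theorem exists_rearrangement {M : ℕ} {h h' : J → Fin M} (hh : Measurable h)
    (hh' : Measurable h') : ∃ Φ : J ≃ᵐ J, MeasurePreserving Φ ν ν ∧
      ν.real {x | h x ≠ h' (Φ x)} ≤
        ∑ i, |ν.real {x | h x ≤ i} - ν.real {x | h' x ≤ i}| := by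
  have hval : Measurable (Fin.val : Fin M → ℕ) := .of_discrete
  obtain ⟨θ, hθ, hθs⟩ := exists_measurableEquiv_sublevel ν (hval.comp hh)
  obtain ⟨θ', hθ', hθs'⟩ := exists_measurableEquiv_sublevel ν (hval.comp hh')
  have hΦ : MeasurePreserving (θ.trans θ'.symm) ν ν := hθ'.symm.comp hθ
  refine ⟨θ.trans θ'.symm, hΦ, ?_⟩
  set Φ := θ.trans θ'.symm with hΦdef
  have hθΦ : ∀ x, θ' (Φ x) = θ x := fun x => by simp [hΦdef]
  let c : Fin M → ℝ := fun i => ν.real {x | h x ≤ i}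
  let c' : Fin M → ℝ := fun i => ν.real {x | h' x ≤ i}
  have h1 : ∀ i : Fin M, {x | h x ≤ i} =ᵐ[ν] {x | (θ x : ℝ) ≤ c i} := fun i => hθs i
  have h2 : ∀ i : Fin M, {x | h' x ≤ i} =ᵐ[ν] {x | (θ' x : ℝ) ≤ c' i} := fun i => hθs' i
  have h3 : ∀ i : Fin M, {x | h' (Φ x) ≤ i} =ᵐ[ν] {x | (θ x : ℝ) ≤ c' i} := by
    intro i
    have := hΦ.quasiMeasurePreserving.preimage_ae_eq (h2 i)
    have heq : Φ ⁻¹' {x | (θ' x : ℝ) ≤ c' i} = {x | (θ x : ℝ) ≤ c' i} := by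
      ext x
      change (θ' (Φ x) : ℝ) ≤ c' i ↔ _
      rw [hθΦ]
      rfl
    rw [heq] at this
    exact this
  have hc : ∀ i, ν.real {x | (θ x : ℝ) ≤ c i} = c i := fun i =>
    (measureReal_congr (h1 i)).symm
  have hc' : ∀ i, ν.real {x | (θ x : ℝ) ≤ c' i} = c' i := by
    intro i
    rw [← measureReal_congr (h3 i)]
    exact congrArg ENNReal.toReal
      (hΦ.measure_preimage (measurableSet_le hh' measurable_const).nullMeasurableSet)
  have hmeas : ∀ t : ℝ, MeasurableSet {x | (θ x : ℝ) ≤ t} := fun t =>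
    measurableSet_le (measurable_subtype_coe.comp θ.measurable) measurable_const
  have hdiff : ∀ s t : ℝ, s ≤ t → ν.real ({x | (θ x : ℝ) ≤ t} \ {x | (θ x : ℝ) ≤ s}) =
      ν.real {x | (θ x : ℝ) ≤ t} - ν.real {x | (θ x : ℝ) ≤ s} := fun s t hst =>
    measureReal_sdiff (fun x (hx : (θ x : ℝ) ≤ s) => hx.trans hst) (hmeas s)
  have hempty : ∀ s t : ℝ, s ≤ t → {x | (θ x : ℝ) ≤ s} \ {x | (θ x : ℝ) ≤ t} = ∅ := fun s t hst =>
    Set.sdiff_eq_empty.mpr (fun x (hx : (θ x : ℝ) ≤ s) => hx.trans hst)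
  have hsymm : ∀ i, ν.real ({x | h x ≤ i} ∆ {x | h' (Φ x) ≤ i}) ≤ |c i - c' i| := by
    intro i
    rw [measureReal_congr ((h1 i).symmDiff (h3 i)), Set.symmDiff_def]
    rcases le_total (c i) (c' i) with hle | hle
    · rw [hempty _ _ hle, Set.empty_union, hdiff _ _ hle, hc, hc', abs_sub_comm]
      exact le_abs_self _
    · rw [hempty _ _ hle, Set.union_empty, hdiff _ _ hle, hc, hc']
      exact le_abs_self _
  -- Two different labels are separated by the threshold at the smaller of them. In the coordinate
  -- `θ` the sublevel sets of both labels are initial intervals, so they differ only by the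
  -- difference of their masses.
  have hsub : {x | h x ≠ h' (Φ x)} ⊆ ⋃ i, {x | h x ≤ i} ∆ {x | h' (Φ x) ≤ i} := by
    intro x hx
    rcases lt_or_gt_of_ne (show h x ≠ h' (Φ x) from hx) with hlt | hlt
    · exact Set.mem_iUnion.mpr ⟨h x, Or.inl ⟨le_refl (h x), not_le.mpr hlt⟩⟩
    · exact Set.mem_iUnion.mpr ⟨h' (Φ x), Or.inr ⟨le_refl (h' (Φ x)), not_le.mpr hlt⟩⟩
  exact (measureReal_mono hsub).trans ((measureReal_iUnion_fintype_le _).trans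
    (Finset.sum_le_sum fun i _ => hsymm i))

end Rearrangement

/-! ### Total boundedness and compactness -/

section TotallyBounded

variable {J H : Type*} [MeasurableSpace J] [NormedAddCommGroup H] [InnerProductSpace ℝ H]
  {ν : Measure J}

theorem cutNorm_smul_const_le [CompleteSpace H] (g : J × J → ℝ) (y : H) :
    cutNorm ν ν (fun p => g p • y) ≤ cutNorm ν ν g * ‖y‖ₑ := by
  refine cutNorm_le fun S T hS hT => ?_
  rw [integral_smul_const, enorm_smul]
  gcongr
  exact enorm_setIntegral_le_cutNorm g hS hT

theorem cutNorm_sum_le {ι : Type*} (s : Finset ι) {w : ι → J × J → H}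
    (hw : ∀ i, Integrable (w i) (ν.prod ν)) :
    cutNorm ν ν (fun p => ∑ i ∈ s, w i p) ≤ ∑ i ∈ s, cutNorm ν ν (w i) := by
  refine cutNorm_le fun S T hS hT => ?_
  rw [integral_finsetSum _ fun i _ => (hw i).integrableOn]
  exact (enorm_sum_le _ _).trans
    (Finset.sum_le_sum fun i _ => enorm_setIntegral_le_cutNorm (w i) hS hT)

/-- A kernel with values in a compact set is uniformly close to a simple function with values in a
finite net of the set. -/
theorem exists_indicator_approx {Ω E : Type*} [MeasurableSpace Ω] {P : Measure Ω}
    [NormedAddCommGroup E] [NormedSpace ℝ E] {N : ℕ} {y : Fin N → E} {K : Set E} {η : ℝ}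
    (hy : ∀ x ∈ K, ∃ i, dist x (y i) < η) {w : Ω → E} (hw : AEStronglyMeasurable w P)
    (hwK : ∀ᵐ p ∂P, w p ∈ K) :
    ∃ A : Fin N → Set Ω, (∀ i, MeasurableSet (A i)) ∧
      ∀ᵐ p ∂P, ‖w p - ∑ i, (A i).indicator (1 : Ω → ℝ) p • y i‖ ≤ η := by
  obtain ⟨g, hg, hwg⟩ := hw
  let D : Fin N → Set Ω := fun i => {p | dist (g p) (y i) < η}
  have hD : ∀ i, MeasurableSet (D i) := fun i =>
    (hg.dist stronglyMeasurable_const).measurableSet_lt stronglyMeasurable_const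
  -- Each point is assigned to the first net element within distance `η`, which makes the sets
  -- disjoint and leaves a single term in the sum.
  refine ⟨fun i => D i \ ⋃ j : {j // j < i}, D j, fun i =>
    (hD i).diff (MeasurableSet.iUnion fun j => hD j), ?_⟩
  filter_upwards [hwg, hwK] with p hp hpK
  rw [hp] at hpK ⊢
  classical
  have hex : ∃ i, p ∈ D i := hy _ hpK
  obtain ⟨i, hi, hmin⟩ := WellFounded.has_min (wellFounded_lt (α := Fin N)) {i | p ∈ D i} hex
  have hmem : p ∈ D i \ ⋃ j : {j // j < i}, D j := by
    refine ⟨hi, fun hU => ?_⟩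
    obtain ⟨j, hj⟩ := Set.mem_iUnion.mp hU
    exact hmin j hj j.2
  have hnot : ∀ j, j ≠ i → p ∉ D j \ ⋃ k : {k // k < j}, D k := by
    intro j hj hpj
    rcases lt_or_gt_of_ne hj with hlt | hlt
    · exact hmin j hpj.1 hlt
    · exact hpj.2 (Set.mem_iUnion.mpr ⟨⟨i, hlt⟩, hi⟩)
  rw [Finset.sum_eq_single i (fun j _ hj => by rw [Set.indicator_of_notMem (hnot j hj), zero_smul])
    (by simp), Set.indicator_of_mem hmem, Pi.one_apply, one_smul, ← dist_eq_norm]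
  exact le_of_lt hi

theorem integrable_step {E : Type*} [NormedAddCommGroup E] [IsFiniteMeasure ν] {M : ℕ}
    (v : Fin M → Fin M → E) {h : J → Fin M} (hh : Measurable h) : Integrable (fun p : J × J => v (h p.1) (h p.2)) (ν.prod ν) := by
  have hm : StronglyMeasurable (fun z : Fin M × Fin M => v z.1 z.2) := .of_discrete
  refine .of_bound (C := ‖v‖) (hm.comp_measurable ((hh.comp measurable_fst).prodMk
    (hh.comp measurable_snd))).aestronglyMeasurable (Eventually.of_forall fun p => ?_)
  exact (norm_le_pi_norm (v (h p.1)) (h p.2)).trans (norm_le_pi_norm v (h p.1))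

/-- The linear combinations of rectangles with bounded coefficients are, up to a small uniform error,
finitely many matrices, spread along finite measurable partitions. -/
theorem exists_finite_matrices {ι E : Type*} [Fintype ι] [NormedAddCommGroup E] [NormedSpace ℝ E]
    (y : ι → E) {η : ℝ} (hη : 0 < η) :
    ∃ (M : ℕ) (V : Set (Fin M → Fin M → E)), V.Finite ∧
      ∀ (a : ι → ℝ) (S T : ι → Set J), (∀ d, |a d| ≤ 1) → (∀ d, MeasurableSet (S d)) →
        (∀ d, MeasurableSet (T d)) → ∃ v ∈ V, ∃ h : J → Fin M, Measurable h ∧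
          ∀ p : J × J, ‖∑ d, (a d * (S d ×ˢ T d).indicator (1 : J × J → ℝ) p) • y d -
            v (h p.1) (h p.2)‖ ≤ η := by
  classical
  -- A cell of the partition is the pattern of memberships in all the sets `S d` and `T d`. The
  -- combination of rectangles is constant on products of cells, with a matrix that depends
  -- continuously on the coefficients alone; a net of the image of the coefficient cube supplies the
  -- finite list.
  let q : (ι → Prop × Prop) ≃ Fin (Fintype.card (ι → Prop × Prop)) := Fintype.equivFin _
  let F : (ι → ℝ) → Fin (Fintype.card (ι → Prop × Prop)) →
      Fin (Fintype.card (ι → Prop × Prop)) → E := fun a i j =>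
    ∑ d, (a d * if (q.symm i d).1 ∧ (q.symm j d).2 then 1 else 0) • y d
  have hF : Continuous F := by
    refine continuous_pi fun i => continuous_pi fun j => continuous_finsetSum _ fun d _ => ?_
    exact ((continuous_apply d).mul continuous_const).smul continuous_const
  obtain ⟨V, -, hV, hcover⟩ := ((isCompact_closedBall (0 : ι → ℝ) 1).image hF).finite_cover_balls hη
  refine ⟨_, V, hV, fun a S T ha hS hT => ?_⟩
  have haF : F a ∈ F '' Metric.closedBall (0 : ι → ℝ) 1 := by
    refine ⟨a, ?_, rfl⟩
    rw [mem_closedBall_zero_iff, pi_norm_le_iff_of_nonneg zero_le_one]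
    exact ha
  obtain ⟨v, hv, hvF⟩ := Set.mem_iUnion₂.mp (hcover haF)
  let r : J → ι → Prop × Prop := fun x d => (x ∈ S d, x ∈ T d)
  have hr : Measurable r := measurable_pi_iff.mpr fun d =>
    (measurableSet_setOfPred.mp (hS d)).prodMk (measurableSet_setOfPred.mp (hT d))
  have hq : Measurable q := .of_discrete
  refine ⟨v, hv, q ∘ r, hq.comp hr, fun p => ?_⟩
  have hval : ∑ d, (a d * (S d ×ˢ T d).indicator (1 : J × J → ℝ) p) • y d =
      F a (q (r p.1)) (q (r p.2)) := by
    refine Finset.sum_congr rfl fun d _ => ?_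
    simp only [Equiv.symm_apply_apply, r, Set.indicator_apply, Set.mem_prod, Pi.one_apply]
  rw [hval, ← dist_eq_norm]
  exact (dist_le_pi_dist (F a (q (r p.1))) (v _) _).trans
    ((dist_le_pi_dist (F a) v _).trans (Metric.mem_ball.mp hvF).le)

/-- Weak regularity for kernels with values in a compact set: up to a small error in cut norm, such
a kernel is one of finitely many matrices, spread along a finite measurable partition. -/
theorem exists_finite_step_approx [IsProbabilityMeasure ν] [CompleteSpace H]
    (K : TopologicalSpace.Compacts H) {ε : ℝ} (hε : 0 < ε) :
    ∃ (M : ℕ) (V : Set (Fin M → Fin M → H)), V.Finite ∧ ∀ w : KernelsIn ν K,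
      ∃ v ∈ V, ∃ h : J → Fin M, Measurable h ∧
        cutNorm ν ν (fun p => w.toFun p - v (h p.1) (h p.2)) ≤ ENNReal.ofReal ε := by
  classical
  obtain ⟨N, y, hy⟩ : ∃ (N : ℕ) (y : Fin N → H), ∀ x ∈ (K : Set H), ∃ i, dist x (y i) < ε / 3 := by
    obtain ⟨t, -, ht, hKt⟩ := K.isCompact.finite_cover_balls (e := ε / 3) (by positivity)
    have : Fintype t := ht.fintype
    refine ⟨Fintype.card t, fun i => (Fintype.equivFin t).symm i, fun x hx => ?_⟩
    obtain ⟨z, hz, hxz⟩ := Set.mem_iUnion₂.mp (hKt hx)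
    exact ⟨Fintype.equivFin t ⟨z, hz⟩, by simpa using hxz⟩
  set C : ℝ := ∑ i, ‖y i‖ with hC
  have hC0 : 0 ≤ C := Finset.sum_nonneg fun i _ => norm_nonneg _
  -- The errors of the individual indicators are weighted by `‖y i‖`, of total `C`; the summand 1
  -- keeps the denominator positive.
  set δ : ℝ := ε / (3 * (1 + C)) with hδ
  have hδ0 : 0 < δ := by positivity
  have hδC : δ * C ≤ ε / 3 := by
    rw [hδ, div_mul_eq_mul_div, div_le_div_iff₀ (by positivity) (by norm_num)]
    nlinarith
  obtain ⟨n, hn⟩ := exists_rectangle_approx (ν := ν) hδ0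
  obtain ⟨M, V, hV, hVa⟩ := exists_finite_matrices (J := J) (fun d : Fin N × Fin n => y d.1)
    (η := ε / 3) (by positivity)
  refine ⟨M, V, hV, fun w => ?_⟩
  obtain ⟨A, hA, hwA⟩ := exists_indicator_approx hy w.prop.1 w.prop.2
  choose a S T ha hS hT hAST using fun i => hn (A i) (hA i)
  obtain ⟨v, hv, h, hh, hvh⟩ := hVa (fun d => a d.1 d.2) (fun d => S d.1 d.2) (fun d => T d.1 d.2)
    (fun d => ha d.1 d.2) (fun d => hS d.1 d.2) (fun d => hT d.1 d.2)
  refine ⟨v, hv, h, hh, ?_⟩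
  let f : Fin N → J × J → ℝ := fun i p => ∑ k, a i k * (S i k ×ˢ T i k).indicator 1 p
  have hind : ∀ B : Set (J × J), MeasurableSet B →
      Integrable (B.indicator (1 : J × J → ℝ)) (ν.prod ν) := fun B hB =>
    (integrable_const (1 : ℝ)).indicator hB
  have hf : ∀ i, Integrable (f i) (ν.prod ν) := fun i => integrable_finsetSum _ fun k _ =>
    (hind _ ((hS i k).prod (hT i k))).const_mul _
  have hsum : ∀ p : J × J, ∑ d : Fin N × Fin n, (a d.1 d.2 *
      (S d.1 d.2 ×ˢ T d.1 d.2).indicator (1 : J × J → ℝ) p) • y d.1 = ∑ i, f i p • y i := by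
    intro p
    rw [Fintype.sum_prod_type]
    exact Finset.sum_congr rfl fun i _ => by simp only [f, Finset.sum_smul]
  have h1 : Integrable (fun p => ∑ i, (A i).indicator (1 : J × J → ℝ) p • y i) (ν.prod ν) :=
    integrable_finsetSum _ fun i _ => (hind _ (hA i)).smul_const _
  have h2 : Integrable (fun p => ∑ i, f i p • y i) (ν.prod ν) :=
    integrable_finsetSum _ fun i _ => (hf i).smul_const _
  have h3 : Integrable (fun p : J × J => v (h p.1) (h p.2)) (ν.prod ν) := integrable_step v hh
  have e1 : cutNorm ν ν (fun p => w.toFun p - ∑ i, (A i).indicator (1 : J × J → ℝ) p • y i) ≤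
      ENNReal.ofReal (ε / 3) := cutNorm_le_of_ae_norm_le hwA
  have e2 : cutNorm ν ν (fun p => ∑ i, (A i).indicator (1 : J × J → ℝ) p • y i -
      ∑ i, f i p • y i) ≤ ENNReal.ofReal (ε / 3) := by
    simp_rw [← Finset.sum_sub_distrib, ← sub_smul]
    refine (cutNorm_sum_le _ fun i => ((hind _ (hA i)).sub (hf i)).smul_const _).trans ?_
    calc _ ≤ ∑ i, ENNReal.ofReal (δ * ‖y i‖) := by
          refine Finset.sum_le_sum fun i _ => ?_
          rw [ENNReal.ofReal_mul hδ0.le, ofReal_norm]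
          refine (cutNorm_smul_const_le _ _).trans ?_
          gcongr
          exact hAST i
      _ = ENNReal.ofReal (δ * C) := by
          rw [← ENNReal.ofReal_sum_of_nonneg fun i _ => by positivity, ← Finset.mul_sum]
      _ ≤ _ := ENNReal.ofReal_le_ofReal hδC
  have e3 : cutNorm ν ν (fun p => ∑ i, f i p • y i - v (h p.1) (h p.2)) ≤
      ENNReal.ofReal (ε / 3) := by
    refine cutNorm_le_of_ae_norm_le (Eventually.of_forall fun p => ?_)
    rw [← hsum]
    exact hvh p
  calc _ ≤ _ := cutNorm_sub_le w.integrable h1 h3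
    _ ≤ _ := add_le_add e1 ((cutNorm_sub_le h1 h2 h3).trans (add_le_add e2 e3))
    _ = ENNReal.ofReal ε := by
        rw [← ENNReal.ofReal_add (by positivity) (by positivity),
          ← ENNReal.ofReal_add (by positivity) (by positivity)]
        congr 1
        ring

/-- Two kernels that come from the same matrix are close if the underlying partitions are. -/
theorem cutNorm_step_sub_le [IsProbabilityMeasure ν] {M : ℕ} (v : Fin M → Fin M → H)
    {h h' : J → Fin M} (hh : Measurable h) (hh' : Measurable h') :
    cutNorm ν ν (fun p => v (h p.1) (h p.2) - v (h' p.1) (h' p.2)) ≤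
      ENNReal.ofReal (4 * ‖v‖ * ν.real {x | h x ≠ h' x}) := by
  set D : Set J := {x | h x ≠ h' x} with hD
  have hDm : MeasurableSet D := (measurableSet_eq_fun hh hh').compl
  refine (cutNorm_le_lintegral _).trans ?_
  have hpt : ∀ p : J × J, ‖v (h p.1) (h p.2) - v (h' p.1) (h' p.2)‖ₑ ≤
      (D ×ˢ Set.univ).indicator (fun _ => ENNReal.ofReal (2 * ‖v‖)) p +
        (Set.univ ×ˢ D).indicator (fun _ => ENNReal.ofReal (2 * ‖v‖)) p := by
    intro p
    have hb : ‖v (h p.1) (h p.2) - v (h' p.1) (h' p.2)‖ₑ ≤ ENNReal.ofReal (2 * ‖v‖) := by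
      rw [← ofReal_norm]
      refine ENNReal.ofReal_le_ofReal ((norm_sub_le _ _).trans ?_)
      have hv : ∀ i j, ‖v i j‖ ≤ ‖v‖ := fun i j =>
        (norm_le_pi_norm (v i) j).trans (norm_le_pi_norm v i)
      linarith [hv (h p.1) (h p.2), hv (h' p.1) (h' p.2)]
    by_cases h1 : p.1 ∈ D
    · rw [Set.indicator_of_mem (Set.mem_prod.mpr ⟨h1, Set.mem_univ _⟩)]
      exact hb.trans le_self_add
    · by_cases h2 : p.2 ∈ D
      · rw [Set.indicator_of_mem (s := Set.univ ×ˢ D) (Set.mem_prod.mpr ⟨Set.mem_univ _, h2⟩)]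
        exact hb.trans le_add_self
      · have e1 : h p.1 = h' p.1 := not_not.mp h1
        have e2 : h p.2 = h' p.2 := not_not.mp h2
        simp [e1, e2]
  refine (lintegral_mono hpt).trans_eq ?_
  rw [lintegral_add_left (measurable_const.indicator (hDm.prod .univ)),
    lintegral_indicator_const (hDm.prod .univ), lintegral_indicator_const (MeasurableSet.univ.prod hDm),
    Measure.prod_prod, Measure.prod_prod, measure_univ, mul_one, one_mul, ← two_mul,
    measureReal_def, ENNReal.ofReal_mul (p := 4 * ‖v‖) (by positivity), ENNReal.ofReal_toReal (measure_ne_top _ _),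
    ← mul_assoc]
  congr 1
  rw [← ENNReal.ofReal_ofNat, ← ENNReal.ofReal_mul (by norm_num)]
  congr 1
  ring

theorem totallyBounded_of_finite_classes {α ι : Type*} [PseudoEMetricSpace α]
    (h : ∀ ε : ℝ, 0 < ε → ∃ (t : Set ι) (c : α → ι), t.Finite ∧ (∀ x, c x ∈ t) ∧
      ∀ x y, c x = c y → edist x y ≤ ENNReal.ofReal ε) :
    TotallyBounded (Set.univ : Set α) := by
  rw [EMetric.totallyBounded_iff]
  intro ε hε
  obtain ⟨r, hr0, hr⟩ := ENNReal.lt_iff_exists_nnreal_btwn.mp hε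
  obtain ⟨t, c, ht, hct, hc⟩ := h r (by exact_mod_cast hr0)
  have hfin : (Set.range c).Finite := ht.subset (Set.range_subset_iff.mpr hct)
  have := hfin.to_subtype
  refine ⟨Set.range (Set.rangeSplitting c), Set.finite_range _, fun x _ => ?_⟩
  refine Set.mem_iUnion₂.mpr ⟨Set.rangeSplitting c ⟨c x, x, rfl⟩, ⟨_, rfl⟩, ?_⟩
  have h1 := hc x (Set.rangeSplitting c ⟨c x, x, rfl⟩) (Set.apply_rangeSplitting c ⟨c x, x, rfl⟩).symm
  refine lt_of_le_of_lt h1 ?_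
  rwa [ENNReal.ofReal_coe_nnreal]

/-- A kernel is classified by its matrix and by its cumulative cell masses rounded to a finite net.
Kernels of one class become close after the rearrangement that matches their partitions. -/
theorem totallyBounded_kernelsIn [StandardBorelSpace J] [IsProbabilityMeasure ν]
    [NullSingletonClass ν] [CompleteSpace H] (K : TopologicalSpace.Compacts H) :
    TotallyBounded (Set.univ : Set (KernelsIn ν K)) := by
  refine totallyBounded_of_finite_classes
    (ι := Σ M : ℕ, (Fin M → Fin M → H) × (Fin M → ℝ)) fun ε hε => ?_
  obtain ⟨M, V, hV, hVw⟩ := exists_finite_step_approx (ν := ν) K (ε := ε / 3) (by positivity)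
  choose v hv h hh hvh using hVw
  obtain ⟨C, hC⟩ := hV.isBounded.exists_norm_le
  -- Equal rounding gives a difference of at most `2 * η` at each of the `M` thresholds, so labels
  -- disagree on mass at most `M * (2 * η)`; `cutNorm_step_sub_le` multiplies this by four times the
  -- norm of the matrix. The added ones avoid zero denominators.
  set η : ℝ := ε / (3 * (8 * (|C| + 1) * (M + 1))) with hη
  have hη0 : 0 < η := by positivity
  let m : KernelsIn ν K → Fin M → ℝ := fun w i => ν.real {x | h w x ≤ i}
  have hm : ∀ w, m w ∈ Metric.closedBall (0 : Fin M → ℝ) 1 := by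
    intro w
    rw [mem_closedBall_zero_iff, pi_norm_le_iff_of_nonneg zero_le_one]
    intro i
    rw [Real.norm_of_nonneg measureReal_nonneg]
    exact measureReal_le_one
  obtain ⟨t, -, ht, hcover⟩ := (isCompact_closedBall (0 : Fin M → ℝ) 1).finite_cover_balls hη0
  choose c hct hc using fun w => Set.mem_iUnion₂.mp (hcover (hm w))
  refine ⟨Sigma.mk M '' (V ×ˢ t), fun w => ⟨M, v w, c w⟩, (hV.prod ht).image _,
    fun w => ⟨(v w, c w), ⟨hv w, hct w⟩, rfl⟩, fun w w' hww' => ?_⟩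
  obtain ⟨hvv, hcc⟩ := Prod.ext_iff.mp (eq_of_heq (Sigma.mk.inj hww').2)
  simp only at hvv hcc
  obtain ⟨Φ, hΦ, hΦh⟩ := exists_rearrangement (ν := ν) (hh w) (hh w')
  have hmm : ∀ i, |ν.real {x | h w x ≤ i} - ν.real {x | h w' x ≤ i}| ≤ 2 * η := by
    intro i
    have h1 := (dist_le_pi_dist (m w) (c w) i).trans (Metric.mem_ball.mp (hc w)).le
    have h2 := (dist_le_pi_dist (m w') (c w') i).trans (Metric.mem_ball.mp (hc w')).le
    rw [← hcc] at h2
    have h3 := dist_triangle_right (m w i) (m w' i) (c w i)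
    rw [Real.dist_eq] at h3
    exact h3.trans (by linarith)
  have hbad : ν.real {x | h w x ≠ h w' (Φ x)} ≤ M * (2 * η) := by
    refine hΦh.trans ((Finset.sum_le_sum fun i _ => hmm i).trans_eq ?_)
    simp
  have hstep := cutNorm_step_sub_le (ν := ν) (v w) (hh w) ((hh w').comp Φ.measurable)
  have hsmall : 4 * ‖v w‖ * ν.real {x | h w x ≠ h w' (Φ x)} ≤ ε / 3 := by
    have hvC : ‖v w‖ ≤ |C| + 1 := (hC _ (hv w)).trans ((le_abs_self C).trans (by linarith))
    calc 4 * ‖v w‖ * ν.real {x | h w x ≠ h w' (Φ x)}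
        ≤ 4 * (|C| + 1) * (M * (2 * η)) := by gcongr
      _ ≤ 4 * (|C| + 1) * ((M + 1) * (2 * η)) := by gcongr; linarith
      _ = ε / 3 := by
          rw [hη]
          field_simp
          ring
  rw [KernelsIn.edist_def]
  refine (cutDist_le_cutNorm Φ hΦ _ _).trans ?_
  have i1 : Integrable (fun p : J × J => v w (h w p.1) (h w p.2)) (ν.prod ν) :=
    integrable_step (v w) (hh w)
  have i2 : Integrable (fun p : J × J => v w (h w' (Φ p.1)) (h w' (Φ p.2))) (ν.prod ν) :=
    integrable_step (v w) ((hh w').comp Φ.measurable)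
  have i3 := integrable_comp_prodMap hΦ w'.integrable
  have e3 : cutNorm ν ν (fun p => v w (h w' (Φ p.1)) (h w' (Φ p.2)) -
      w'.toFun (Φ p.1, Φ p.2)) ≤ ENNReal.ofReal (ε / 3) := by
    rw [hvv]
    refine (cutNorm_comp Φ hΦ (fun p => v w' (h w' p.1) (h w' p.2) - w'.toFun p)).trans_le ?_
    rw [cutNorm_sub_comm]
    exact hvh w'
  calc _ ≤ _ := cutNorm_sub_le w.integrable i1 i3
    _ ≤ _ := add_le_add (hvh w) ((cutNorm_sub_le i1 i2 i3).trans (add_le_add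
        (hstep.trans (ENNReal.ofReal_le_ofReal hsmall)) e3))
    _ = ENNReal.ofReal ε := by
        rw [← ENNReal.ofReal_add (by positivity) (by positivity),
          ← ENNReal.ofReal_add (by positivity) (by positivity)]
        congr 1
        ring

/-- The compactness theorem for kernels with values in a compact convex set. -/
theorem compactSpace_kernelsIn [StandardBorelSpace J] [IsProbabilityMeasure ν]
    [NullSingletonClass ν] [CompleteSpace H] (K : TopologicalSpace.Compacts H)
    (hconv : Convex ℝ (K : Set H)) : CompactSpace (KernelsIn ν K) := by
  have := completeSpace_kernelsIn (ν := ν) K hconv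
  exact ⟨isCompact_iff_totallyBounded_isComplete.mpr
    ⟨totallyBounded_kernelsIn K, isClosed_univ.isComplete⟩⟩

end TotallyBounded

/-! ### Transport to a single space and sequential compactness -/

section Isomorphic

variable {I J : Type*} [MeasurableSpace I] [StandardBorelSpace I] [MeasurableSpace J]
  [StandardBorelSpace J]

theorem exists_measurePreserving_equiv (μ : Measure I) [IsProbabilityMeasure μ]
    [NullSingletonClass μ] (ν : Measure J) [IsProbabilityMeasure ν] [NullSingletonClass ν] :
    ∃ θ : I ≃ᵐ J, MeasurePreserving θ μ ν := by
  obtain ⟨θ, hθ, -⟩ := exists_measurableEquiv_sublevel μ (measurable_const (a := 0))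
  obtain ⟨η, hη, -⟩ := exists_measurableEquiv_sublevel ν (measurable_const (a := 0))
  exact ⟨θ.trans η.symm, hη.symm.comp hθ⟩

end Isomorphic

/-- Sequential compactness in the unlabeled cut distance for kernels on varying atomless standard
probability spaces with values in a compact convex set. -/
theorem exists_subseq_tendsto_cutDist {I : ℕ → Type*} [∀ n, MeasurableSpace (I n)]
    [∀ n, StandardBorelSpace (I n)] (μ : ∀ n, Measure (I n)) [∀ n, IsProbabilityMeasure (μ n)]
    [∀ n, NullSingletonClass (μ n)] {J : Type*} [MeasurableSpace J] [StandardBorelSpace J]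
    (ν : Measure J) [IsProbabilityMeasure ν] [NullSingletonClass ν] {H : Type*}
    [NormedAddCommGroup H] [InnerProductSpace ℝ H] [CompleteSpace H] {K : Set H}
    (hK : IsCompact K) (hconv : Convex ℝ K) {w : ∀ n, I n × I n → H}
    (hw : ∀ n, AEStronglyMeasurable (w n) ((μ n).prod (μ n)))
    (hwK : ∀ n, ∀ᵐ p ∂((μ n).prod (μ n)), w n p ∈ K) :
    ∃ φ : ℕ → ℕ, StrictMono φ ∧ ∃ u : J × J → H, AEStronglyMeasurable u (ν.prod ν) ∧
      (∀ᵐ p ∂(ν.prod ν), u p ∈ K) ∧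
      Tendsto (fun k => cutDist (μ (φ k)) ν (w (φ k)) u) atTop (𝓝 0) := by
  choose θ hθ using fun n => exists_measurePreserving_equiv (μ n) ν
  let C : TopologicalSpace.Compacts H := ⟨K, hK⟩
  have := compactSpace_kernelsIn (ν := ν) C hconv
  let v : ℕ → KernelsIn ν C := fun n => ⟨fun p => w n ((θ n).symm p.1, (θ n).symm p.2),
    (hw n).comp_measurePreserving ((hθ n).symm.prod (hθ n).symm),
    ((hθ n).symm.prod (hθ n).symm).quasiMeasurePreserving.ae (hwK n)⟩
  obtain ⟨u, φ, hφ, hu⟩ := CompactSpace.tendsto_subseq v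
  refine ⟨φ, hφ, u.toFun, u.prop.1, u.prop.2, ?_⟩
  rw [tendsto_iff_edist_tendsto_0] at hu
  refine tendsto_of_tendsto_of_tendsto_of_le_of_le tendsto_const_nhds hu (fun _ => zero_le)
    fun k => ?_
  have hwi := integrable_of_ae_mem_isBounded hK.isBounded (hw (φ k)) (hwK (φ k))
  -- The transported kernel differs from the original one by an isomorphism only.
  have h0 : cutDist (μ (φ k)) ν (w (φ k)) (v (φ k)).toFun = 0 := by
    refine le_antisymm ((cutDist_le_cutNorm (θ (φ k)) (hθ (φ k)) _ _).trans ?_) zero_le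
    simp [v, cutNorm_eq_iSup_enorm]
  refine (cutDist_triangle hwi (v (φ k)).integrable u.integrable).trans ?_
  rw [h0, zero_add]
  exact le_rfl

/-! ### Point masses in the negative Sobolev space -/

section Dirac

/-- The point mass at `x`, as an element of `H^{-1}`. -/
def diracHNegOne (x : UnitAddCircle) : HNegOne := measureToHNegOne (Measure.dirac x)

theorem diracHNegOne_apply (x : UnitAddCircle) (m : ℤ) : diracHNegOne x m =
    ((√(1 + 4 * Real.pi ^ 2 * (m : ℝ) ^ 2))⁻¹ : ℝ) • (fourier (-m) x : ℂ) := by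
  change weightedCoeff (Measure.dirac x) m = _
  rw [weightedCoeff, fourierCoeffMeasure, integral_dirac]

theorem continuous_diracHNegOne_apply (m : ℤ) : Continuous fun x => diracHNegOne x m := by
  simp_rw [diracHNegOne_apply]
  exact (map_continuous (fourier (-m) : C(UnitAddCircle, ℂ))).const_smul
    ((√(1 + 4 * Real.pi ^ 2 * (m : ℝ) ^ 2))⁻¹ : ℝ)

/-- Each coefficient is continuous in the point and has modulus independent of it, so four times the
series of the squared norm at `x` dominates and the limit may be taken termwise. -/
theorem continuous_diracHNegOne : Continuous diracHNegOne := by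
  rw [continuous_iff_continuousAt]
  intro x
  rw [ContinuousAt, tendsto_iff_norm_sub_tendsto_zero]
  have h2 : (0 : ℝ) < (2 : ℝ≥0∞).toReal := by norm_num
  have hsum : Tendsto (fun y => ∑' m : ℤ, ‖(diracHNegOne y - diracHNegOne x) m‖ ^
      (2 : ℝ≥0∞).toReal) (𝓝 x) (𝓝 (∑' _ : ℤ, (0 : ℝ))) := by
    have hS := (lp.hasSum_norm h2 (diracHNegOne x)).summable.mul_left ((2 : ℝ) ^ (2 : ℝ≥0∞).toReal)
    refine tendsto_tsum_of_dominated_convergence hS (fun m => ?_) (Eventually.of_forall fun y m => ?_)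
    · have h1 : Continuous fun y => ‖(diracHNegOne y - diracHNegOne x) m‖ ^
          (2 : ℝ≥0∞).toReal := by
        refine Continuous.rpow_const (Continuous.norm ?_) fun _ => Or.inr h2.le
        exact (continuous_diracHNegOne_apply m).sub continuous_const
      have h3 := h1.tendsto x
      simpa using h3
    · have hn : ∀ y, ‖diracHNegOne y m‖ = ‖diracHNegOne x m‖ := fun y => by
        simp_rw [diracHNegOne_apply, norm_smul, fourier_apply, Circle.norm_coe]
      rw [Real.norm_of_nonneg (by positivity), ← Real.mul_rpow (by norm_num) (norm_nonneg _)]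
      refine Real.rpow_le_rpow (norm_nonneg _) ?_ h2.le
      rw [lp.coeFn_sub, Pi.sub_apply]
      refine (norm_sub_le _ _).trans ?_
      rw [hn y, two_mul]
  rw [tsum_zero] at hsum
  have h4 := hsum.rpow_const (p := 1 / (2 : ℝ≥0∞).toReal) (Or.inr (by positivity))
  rw [Real.zero_rpow (by norm_num)] at h4
  exact h4.congr fun y => (lp.norm_eq_tsum_rpow h2 _).symm

/-- The first coefficient is a nonzero multiple of the standard embedding of the compact circle in
the plane. Hence one coefficient recovers the point, and limits of coefficients are again
coefficients of points. -/
theorem isClosedEmbedding_diracHNegOne_one :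
    IsClosedEmbedding fun x : UnitAddCircle => diracHNegOne x 1 := by
  refine (continuous_diracHNegOne_apply 1).isClosedEmbedding fun x y hxy => ?_
  simp only [diracHNegOne_apply] at hxy
  have hc : ((√(1 + 4 * Real.pi ^ 2 * ((1 : ℤ) : ℝ) ^ 2))⁻¹ : ℝ) ≠ 0 := by positivity
  have h1 := smul_right_injective ℂ hc hxy
  rw [fourier_apply, fourier_apply] at h1
  have h2 := AddCircle.injective_toCircle one_ne_zero (Circle.ext h1)
  simpa using h2

theorem exists_norm_diracHNegOne_le : ∃ R : ℝ, ∀ x, ‖diracHNegOne x‖ ≤ R := by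
  obtain ⟨R, hR⟩ := (isCompact_range continuous_diracHNegOne).isBounded.exists_norm_le
  exact ⟨R, fun x => hR _ ⟨x, rfl⟩⟩

theorem pairKernel_apply_one {I : Type*} (w : I × I → ℝ) (X : I → UnitAddCircle) (p : I × I) :
    pairKernel w X p 1 = w p • diracHNegOne (X p.2) := rfl

/-- The value `(δ_x, c δ_x)` of the kernel of a pair. -/
def pairValue (z : UnitAddCircle × ℝ) : PiLp 2 (fun _ : Fin 2 => HNegOne) :=
  WithLp.toLp 2 ![diracHNegOne z.1, z.2 • diracHNegOne z.1]

theorem continuous_pairValue : Continuous pairValue := by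
  refine (PiLp.continuous_toLp 2 _).comp (continuous_pi fun i => ?_)
  have h := continuous_diracHNegOne.comp (continuous_fst (X := UnitAddCircle) (Y := ℝ))
  fin_cases i
  · exact h
  · exact continuous_snd.smul h

theorem pairKernel_eq_pairValue {I : Type*} (w : I × I → ℝ) (X : I → UnitAddCircle) :
    pairKernel w X = fun p => pairValue (X p.2, w p) := rfl

theorem aestronglyMeasurable_pairKernel {I : Type*} [MeasurableSpace I] {μ : Measure I}
    {w : I × I → ℝ} (hw : AEStronglyMeasurable w (μ.prod μ)) {X : I → UnitAddCircle}
    (hX : Measurable X) : AEStronglyMeasurable (pairKernel w X) (μ.prod μ) := by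
  rw [pairKernel_eq_pairValue]
  exact continuous_pairValue.comp_aestronglyMeasurable
    ((hX.comp measurable_snd).aestronglyMeasurable.prodMk hw)

theorem isCompact_image_pairValue (C : ℝ) :
    IsCompact (pairValue '' (Set.univ ×ˢ Set.Icc (-C) C)) :=
  (isCompact_univ.prod isCompact_Icc).image continuous_pairValue

theorem ae_pairKernel_mem {I : Type*} [MeasurableSpace I] {μ : Measure I} {w : I × I → ℝ} {C : ℝ}
    (hw : ∀ᵐ p ∂(μ.prod μ), |w p| ≤ C) (X : I → UnitAddCircle) :
    ∀ᵐ p ∂(μ.prod μ), pairKernel w X p ∈ pairValue '' (Set.univ ×ˢ Set.Icc (-C) C) :=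
  hw.mono fun p hp => ⟨(X p.2, w p), ⟨trivial, abs_le.mp hp⟩, rfl⟩

end Dirac

/-! ### Information carried by integrals over rectangles -/

section Rectangles

variable {Ω I J : Type*} [MeasurableSpace Ω] [MeasurableSpace I] [MeasurableSpace J]

theorem ae_eq_zero_of_forall_rectangle {E : Type*} [NormedAddCommGroup E] [NormedSpace ℝ E]
    [CompleteSpace E] {μ : Measure I} {ν : Measure J} [IsFiniteMeasure μ] [IsFiniteMeasure ν]
    {f : I × J → E} (hf : Integrable f (μ.prod ν))
    (h : ∀ S T, MeasurableSet S → MeasurableSet T → ∫ p in S ×ˢ T, f p ∂(μ.prod ν) = 0) :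
    f =ᵐ[μ.prod ν] 0 := by
  refine hf.ae_eq_zero_of_forall_setIntegral_eq_zero fun A hA hfin => ?_
  clear hfin
  induction A, hA using MeasurableSpace.induction_on_inter generateFrom_prod.symm
    isPiSystem_prod with
  | empty => simp
  | basic A hA =>
    obtain ⟨S, hS, T, hT, rfl⟩ := hA
    exact h S T hS hT
  | compl A hA ih =>
    -- The whole product is itself a rectangle, so the total integral vanishes and complements
    -- follow.
    have h0 := h Set.univ Set.univ .univ .univ
    rw [Set.univ_prod_univ, setIntegral_univ, ← integral_add_compl hA hf, ih, zero_add] at h0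
    exact h0
  | iUnion A hd hA ih =>
    rw [integral_iUnion hA hd hf.integrableOn]
    simp [ih]

theorem ae_eq_of_forall_rectangle {E : Type*} [NormedAddCommGroup E] [NormedSpace ℝ E]
    [CompleteSpace E] {μ : Measure I} {ν : Measure J} [IsFiniteMeasure μ] [IsFiniteMeasure ν]
    {f g : I × J → E} (hf : Integrable f (μ.prod ν)) (hg : Integrable g (μ.prod ν))
    (h : ∀ S T, MeasurableSet S → MeasurableSet T →
      ∫ p in S ×ˢ T, f p ∂(μ.prod ν) = ∫ p in S ×ˢ T, g p ∂(μ.prod ν)) :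
    f =ᵐ[μ.prod ν] g := by
  have := ae_eq_zero_of_forall_rectangle (hf.sub hg) fun S T hS hT => by
    simp_rw [Pi.sub_apply]
    rw [integral_sub hf.integrableOn hg.integrableOn, h S T hS hT, sub_self]
  filter_upwards [this] with p hp
  exact sub_eq_zero.mp hp

/-- It suffices to integrate over the sets where the function is nonnegative and nonpositive. For
functions of one variable this turns cut norm control into L¹ control. -/
theorem lintegral_enorm_le_of_forall_setIntegral {P : Measure Ω} {g : Ω → ℝ}
    (hg : Integrable g P) {c : ℝ≥0∞} (h : ∀ T, MeasurableSet T → ‖∫ x in T, g x ∂P‖ₑ ≤ c) :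
    ∫⁻ x, ‖g x‖ₑ ∂P ≤ 2 * c := by
  obtain ⟨f, hf, hgf⟩ := hg.aestronglyMeasurable
  have hfi : Integrable f P := hg.congr hgf
  have hfc : ∀ T, MeasurableSet T → ‖∫ x in T, f x ∂P‖ₑ ≤ c := fun T hT => by
    rw [← integral_congr_ae (ae_restrict_of_ae hgf)]
    exact h T hT
  rw [lintegral_congr_ae (hgf.mono fun x hx => by rw [hx]),
    ← ofReal_integral_norm_eq_lintegral_enorm hfi, integral_norm_eq_pos_sub_neg hfi]
  calc _ ≤ ENNReal.ofReal (‖∫ x in {x | 0 ≤ f x}, f x ∂P‖ + ‖∫ x in {x | f x ≤ 0}, f x ∂P‖) :=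
        ENNReal.ofReal_le_ofReal ((Real.le_norm_self _).trans (norm_sub_le _ _))
    _ = ‖∫ x in {x | 0 ≤ f x}, f x ∂P‖ₑ + ‖∫ x in {x | f x ≤ 0}, f x ∂P‖ₑ := by
        rw [ENNReal.ofReal_add (norm_nonneg _) (norm_nonneg _), ofReal_norm, ofReal_norm]
    _ ≤ c + c := add_le_add (hfc _ (stronglyMeasurable_const.measurableSet_le hf))
        (hfc _ (hf.measurableSet_le stronglyMeasurable_const))
    _ = 2 * c := (two_mul c).symm

theorem lintegral_enorm_le_of_forall_setIntegral_complex {P : Measure Ω} {g : Ω → ℂ}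
    (hg : Integrable g P) {c : ℝ≥0∞} (h : ∀ T, MeasurableSet T → ‖∫ x in T, g x ∂P‖ₑ ≤ c) :
    ∫⁻ x, ‖g x‖ₑ ∂P ≤ 2 * c + 2 * c := by
  have hL : ∀ L : ℂ →L[ℝ] ℝ, (∀ z, ‖L z‖ ≤ ‖z‖) → ∫⁻ x, ‖L (g x)‖ₑ ∂P ≤ 2 * c := by
    intro L hL
    refine lintegral_enorm_le_of_forall_setIntegral (L.integrable_comp hg) fun T hT => ?_
    rw [L.integral_comp_comm hg.integrableOn]
    exact (enorm_le_iff_norm_le.mpr (hL _)).trans (h T hT)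
  calc ∫⁻ x, ‖g x‖ₑ ∂P ≤ ∫⁻ x, (‖Complex.reCLM (g x)‖ₑ + ‖Complex.imCLM (g x)‖ₑ) ∂P := by
        refine lintegral_mono fun x => ?_
        rw [← ofReal_norm, ← ofReal_norm, ← ofReal_norm,
          ← ENNReal.ofReal_add (norm_nonneg _) (norm_nonneg _)]
        exact ENNReal.ofReal_le_ofReal (Complex.norm_le_abs_re_add_abs_im (g x))
    _ = ∫⁻ x, ‖Complex.reCLM (g x)‖ₑ ∂P + ∫⁻ x, ‖Complex.imCLM (g x)‖ₑ ∂P :=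
        lintegral_add_left' (Complex.reCLM.integrable_comp hg).aestronglyMeasurable.enorm _
    _ ≤ _ := add_le_add (hL _ Complex.abs_re_le_norm) (hL _ Complex.abs_im_le_norm)

theorem tendsto_setIntegral_of_tendsto_cutNorm {H F : Type*} [NormedAddCommGroup H]
    [InnerProductSpace ℝ H] [CompleteSpace H] [NormedAddCommGroup F] [NormedSpace ℝ F]
    [CompleteSpace F] {μ : Measure I} {ν : Measure J} {v : ℕ → I × J → H} {u : I × J → H}
    (hv : ∀ j, Integrable (v j) (μ.prod ν)) (hu : Integrable u (μ.prod ν))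
    (h : Tendsto (fun j => cutNorm μ ν (fun p => v j p - u p)) atTop (𝓝 0)) (L : H →L[ℝ] F)
    {S : Set I} (hS : MeasurableSet S) {T : Set J} (hT : MeasurableSet T) :
    Tendsto (fun j => ∫ p in S ×ˢ T, L (v j p) ∂(μ.prod ν)) atTop
      (𝓝 (∫ p in S ×ˢ T, L (u p) ∂(μ.prod ν))) := by
  simp_rw [L.integral_comp_comm (hv _).integrableOn, L.integral_comp_comm hu.integrableOn]
  refine (L.continuous.tendsto _).comp ?_
  rw [tendsto_iff_edist_tendsto_0]
  refine tendsto_of_tendsto_of_tendsto_of_le_of_le tendsto_const_nhds h (fun _ => zero_le)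
    fun j => ?_
  dsimp only
  rw [edist_eq_enorm_sub, ← integral_sub (hv j).integrableOn hu.integrableOn]
  exact enorm_setIntegral_le_cutNorm (fun p => v j p - u p) hS hT

end Rectangles

/-! ### Closedness of the kernels of pairs -/

section PairClosed

variable {J : Type*} [MeasurableSpace J] {ν : Measure J} [IsProbabilityMeasure ν]

theorem integrable_pairKernel {w : J × J → ℝ} {X : J → UnitAddCircle} {C : ℝ}
    (hw : AEStronglyMeasurable w (ν.prod ν)) (hwC : ∀ᵐ p ∂(ν.prod ν), |w p| ≤ C)
    (hX : Measurable X) : Integrable (pairKernel w X) (ν.prod ν) :=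
  integrable_of_ae_mem_isBounded (isCompact_image_pairValue C).isBounded
    (aestronglyMeasurable_pairKernel hw hX) (ae_pairKernel_mem hwC X)

/-- If the kernels of pairs converge in cut norm, then the positions converge almost everywhere along
a subsequence. -/
theorem exists_subseq_tendsto_position {w : ℕ → J × J → ℝ} {X : ℕ → J → UnitAddCircle} {C : ℝ}
    (hw : ∀ j, AEStronglyMeasurable (w j) (ν.prod ν))
    (hwC : ∀ j, ∀ᵐ p ∂(ν.prod ν), |w j p| ≤ C) (hX : ∀ j, Measurable (X j))
    {u : J × J → PiLp 2 (fun _ : Fin 2 => HNegOne)} (hu : Integrable u (ν.prod ν))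
    (h : Tendsto (fun j => cutNorm ν ν (fun p => pairKernel (w j) (X j) p - u p)) atTop (𝓝 0)) :
    ∃ ψ : ℕ → ℕ, StrictMono ψ ∧ ∃ Y : J → UnitAddCircle, Measurable Y ∧
      ∀ᵐ ζ ∂ν, Tendsto (fun j => X (ψ j) ζ) atTop (𝓝 (Y ζ)) := by
  -- The functional reads the first Fourier coefficient of the first component, which on kernels of
  -- pairs depends on `ζ` only. Strips `univ ×ˢ T` therefore suffice to compare it with the average
  -- `y` over `ξ`.
  let L : PiLp 2 (fun _ : Fin 2 => HNegOne) →L[ℝ] ℂ :=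
    (lp.evalCLM ℝ (fun _ : ℤ => ℂ) 2 1).comp (PiLp.proj 2 (fun _ : Fin 2 => HNegOne) 0)
  let z : ℕ → J → ℂ := fun j ζ => diracHNegOne (X j ζ) 1
  have hL : ∀ j p, L (pairKernel (w j) (X j) p) = z j p.2 := fun j p => rfl
  have hvi : ∀ j, Integrable (pairKernel (w j) (X j)) (ν.prod ν) := fun j =>
    integrable_pairKernel (hw j) (hwC j) (hX j)
  have hui : Integrable (fun p => L (u p)) (ν.prod ν) := L.integrable_comp hu
  have hzm : ∀ j, AEStronglyMeasurable (z j) ν := fun j =>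
    (isClosedEmbedding_diracHNegOne_one.continuous.measurable.comp (hX j)).aestronglyMeasurable
  obtain ⟨R, hR⟩ := exists_norm_diracHNegOne_le
  have hzi : ∀ j, Integrable (z j) ν := fun j => .of_bound (hzm j) R (Eventually.of_forall fun ζ =>
    (lp.norm_apply_le_norm (by norm_num) _ _).trans (hR _))
  let y : J → ℂ := fun ζ => ∫ ξ, L (u (ξ, ζ)) ∂ν
  have hyi : Integrable y ν := hui.integral_prod_right
  have hL1 : ∀ j, ∫⁻ ζ, ‖z j ζ - y ζ‖ₑ ∂ν ≤
      4 * (‖L‖ₑ * cutNorm ν ν (fun p => pairKernel (w j) (X j) p - u p)) := by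
    intro j
    refine (lintegral_enorm_le_of_forall_setIntegral_complex ((hzi j).sub hyi)
      (c := ‖L‖ₑ * cutNorm ν ν (fun p => pairKernel (w j) (X j) p - u p)) fun T hT => ?_).trans_eq
      (by rw [← add_mul]; norm_num)
    have hsub : Integrable (fun p => pairKernel (w j) (X j) p - u p) (ν.prod ν) := (hvi j).sub hu
    have heq : ∫ ζ in T, (z j - y) ζ ∂ν =
        L (∫ p in Set.univ ×ˢ T, (pairKernel (w j) (X j) p - u p) ∂(ν.prod ν)) := by
      rw [← L.integral_comp_comm hsub.integrableOn, ← Measure.prod_restrict, Measure.restrict_univ,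
        integral_prod_symm _ (by
          have := (L.integrable_comp hsub).integrableOn (s := Set.univ ×ˢ T)
          rwa [IntegrableOn, ← Measure.prod_restrict, Measure.restrict_univ] at this)]
      refine integral_congr_ae (ae_restrict_of_ae ?_)
      filter_upwards [hui.prod_left_ae] with ζ hζ
      simp_rw [map_sub, hL]
      rw [integral_sub (integrable_const _) hζ]
      simp [y]
    rw [heq]
    refine (L.le_opENorm _).trans ?_
    gcongr
    exact enorm_setIntegral_le_cutNorm (fun p => pairKernel (w j) (X j) p - u p) .univ hT
  have hL10 : Tendsto (fun j => eLpNorm (z j - y) 1 ν) atTop (𝓝 0) := by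
    have h1 : Tendsto (fun j => 4 * (‖L‖ₑ * cutNorm ν ν
        (fun p => pairKernel (w j) (X j) p - u p))) atTop (𝓝 0) := by
      have := ENNReal.Tendsto.const_mul (a := 4)
        (ENNReal.Tendsto.const_mul (a := ‖L‖ₑ) h (Or.inr enorm_ne_top)) (Or.inr (by simp))
      simpa using this
    refine tendsto_of_tendsto_of_tendsto_of_le_of_le tendsto_const_nhds h1 (fun _ => zero_le)
      fun j => ?_
    rw [eLpNorm_one_eq_lintegral_enorm]
    exact hL1 j
  obtain ⟨ψ, hψ, hψz⟩ := (tendstoInMeasure_of_tendsto_eLpNorm one_ne_zero hzm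
    hyi.aestronglyMeasurable hL10).exists_seq_tendsto_ae
  obtain ⟨Y, hY, hXY⟩ := measurable_limit_of_tendsto_metrizable_ae (μ := ν) (L := atTop)
    (f := fun j => X (ψ j)) (fun j => (hX _).aemeasurable) (by
      filter_upwards [hψz] with ζ hζ
      obtain ⟨x, hx⟩ := isClosedEmbedding_diracHNegOne_one.isClosed_range.mem_of_tendsto hζ
        (Eventually.of_forall fun j => ⟨X (ψ j) ζ, rfl⟩)
      refine ⟨x, isClosedEmbedding_diracHNegOne_one.tendsto_nhds_iff.mpr ?_⟩
      rw [show diracHNegOne x 1 = y ζ from hx]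
      exact hζ)
  exact ⟨ψ, hψ, Y, hY, hXY⟩

/-- The kernels of pairs are closed for convergence in cut norm. -/
theorem exists_pair_of_tendsto_cutNorm {w : ℕ → J × J → ℝ} {X : ℕ → J → UnitAddCircle} {C : ℝ}
    (hw : ∀ j, AEStronglyMeasurable (w j) (ν.prod ν))
    (hwC : ∀ j, ∀ᵐ p ∂(ν.prod ν), |w j p| ≤ C) (hX : ∀ j, Measurable (X j))
    {u : J × J → PiLp 2 (fun _ : Fin 2 => HNegOne)} (hu : Integrable u (ν.prod ν))
    (h : Tendsto (fun j => cutNorm ν ν (fun p => pairKernel (w j) (X j) p - u p)) atTop (𝓝 0)) :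
    ∃ (wlim : J × J → ℝ) (Y : J → UnitAddCircle), MemLp wlim ⊤ (ν.prod ν) ∧ Measurable Y ∧
      u =ᵐ[ν.prod ν] pairKernel wlim Y := by
  obtain ⟨ψ, hψ, Y, hY, hXY⟩ := exists_subseq_tendsto_position hw hwC hX hu h
  obtain ⟨R, hR⟩ := exists_norm_diracHNegOne_le
  have hvi : ∀ j, Integrable (pairKernel (w (ψ j)) (X (ψ j))) (ν.prod ν) := fun j =>
    integrable_pairKernel (hw _) (hwC _) (hX _)
  have hlim : ∀ (i : Fin 2) (S T : Set J), MeasurableSet S → MeasurableSet T →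
      Tendsto (fun j => ∫ p in S ×ˢ T, pairKernel (w (ψ j)) (X (ψ j)) p i ∂(ν.prod ν)) atTop
        (𝓝 (∫ p in S ×ˢ T, u p i ∂(ν.prod ν))) := fun i S T hS hT =>
    tendsto_setIntegral_of_tendsto_cutNorm hvi hu (h.comp hψ.tendsto_atTop)
      (PiLp.proj 2 (fun _ : Fin 2 => HNegOne) i) hS hT
  have hui : ∀ i : Fin 2, Integrable (fun p => u p i) (ν.prod ν) := fun i =>
    (PiLp.proj (𝕜 := ℝ) 2 (fun _ : Fin 2 => HNegOne) i).integrable_comp hu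
  have hδm : ∀ {Z : J → UnitAddCircle}, Measurable Z →
      AEStronglyMeasurable (fun p : J × J => diracHNegOne (Z p.2)) (ν.prod ν) := fun hZ =>
    continuous_diracHNegOne.comp_aestronglyMeasurable
      (hZ.comp measurable_snd).aestronglyMeasurable
  have hδi : ∀ {Z : J → UnitAddCircle}, Measurable Z →
      Integrable (fun p : J × J => diracHNegOne (Z p.2)) (ν.prod ν) := fun hZ =>
    .of_bound (hδm hZ) R (Eventually.of_forall fun p => hR _)
  have hδlim : ∀ᵐ p ∂(ν.prod ν), Tendsto (fun j => diracHNegOne (X (ψ j) p.2)) atTop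
      (𝓝 (diracHNegOne (Y p.2))) := by
    filter_upwards [Measure.quasiMeasurePreserving_snd.ae hXY] with p hp
    exact (continuous_diracHNegOne.tendsto _).comp hp
  obtain ⟨w', hw'm, hw'C, hw'⟩ := exists_weak_limit (K := Set.Icc (-C) C) isCompact_Icc
    (convex_Icc _ _) (fun j => hw (ψ j)) (fun j => (hwC (ψ j)).mono fun p hp => abs_le.mp hp)
    (hyperfilter ℕ)
  have hwδi : ∀ {g : J × J → ℝ} {Z : J → UnitAddCircle}, AEStronglyMeasurable g (ν.prod ν) →
      (∀ᵐ p ∂(ν.prod ν), |g p| ≤ C) → Measurable Z →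
      Integrable (fun p : J × J => g p • diracHNegOne (Z p.2)) (ν.prod ν) := fun hg hgC hZ =>
    (hδi hZ).bdd_smul C hg hgC
  have hw'a : ∀ᵐ p ∂(ν.prod ν), |w' p| ≤ C := hw'C.mono fun p hp => abs_le.mpr hp
  have h0 : (fun p => u p 0) =ᵐ[ν.prod ν] fun p => diracHNegOne (Y p.2) := by
    refine ae_eq_of_forall_rectangle (hui 0) (hδi hY) fun S T hS hT => ?_
    refine tendsto_nhds_unique (hlim 0 S T hS hT) ?_
    exact tendsto_integral_of_dominated_convergence (fun _ => R)
      (fun j => (hδm (hX (ψ j))).restrict) (integrable_const _)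
      (fun j => Eventually.of_forall fun p => hR _) (ae_restrict_of_ae hδlim)
  have h1 : (fun p => u p 1) =ᵐ[ν.prod ν] fun p => w' p • diracHNegOne (Y p.2) := by
    refine ae_eq_of_forall_rectangle (hui 1) (hwδi hw'm hw'a hY) fun S T hS hT => ?_
    -- Since the weights are uniformly bounded and the point masses converge in norm almost
    -- everywhere, the moving positions may be replaced by their limit before the weak limit of the
    -- weights is taken.
    have hdiff : Tendsto (fun j => ∫ p in S ×ˢ T, (w (ψ j) p • diracHNegOne (X (ψ j) p.2) -
        w (ψ j) p • diracHNegOne (Y p.2)) ∂(ν.prod ν)) atTop (𝓝 0) := by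
      rw [← integral_zero (J × J) HNegOne (μ := (ν.prod ν).restrict (S ×ˢ T))]
      refine tendsto_integral_of_dominated_convergence (fun _ => C * (R + R))
        (fun j => ((hwδi (hw _) (hwC _) (hX _)).sub
          (hwδi (hw _) (hwC _) hY)).aestronglyMeasurable.restrict) (integrable_const _)
        (fun j => ?_) ?_
      · filter_upwards [ae_restrict_of_ae (hwC (ψ j))] with p hp
        rw [← smul_sub, norm_smul]
        exact mul_le_mul hp ((norm_sub_le _ _).trans (add_le_add (hR _) (hR _))) (norm_nonneg _)
          ((abs_nonneg _).trans hp)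
      · filter_upwards [ae_restrict_of_ae hδlim,
          ae_restrict_of_ae (ae_all_iff.mpr fun j => hwC (ψ j))] with p hp hpC
        have h2 := (tendsto_iff_norm_sub_tendsto_zero.mp hp).const_mul C
        rw [mul_zero] at h2
        refine squeeze_zero_norm (fun j => ?_) h2
        rw [← smul_sub, norm_smul]
        exact mul_le_mul_of_nonneg_right (hpC j) (norm_nonneg _)
    have hY1 : Tendsto (fun j => ∫ p in S ×ˢ T, w (ψ j) p • diracHNegOne (Y p.2) ∂(ν.prod ν)) atTop
        (𝓝 (∫ p in S ×ˢ T, u p 1 ∂(ν.prod ν))) := by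
      have h3 := (hlim 1 S T hS hT).sub hdiff
      rw [sub_zero] at h3
      refine h3.congr fun j => ?_
      rw [integral_sub (hwδi (hw _) (hwC _) (hX _)).integrableOn
        (hwδi (hw _) (hwC _) hY).integrableOn]
      simp_rw [pairKernel_apply_one]
      abel
    refine ext_inner_left ℝ fun e => ?_
    have hin : ∀ g : J × J → ℝ, AEStronglyMeasurable g (ν.prod ν) →
        (∀ᵐ p ∂(ν.prod ν), |g p| ≤ C) →
        inner ℝ e (∫ p in S ×ˢ T, g p • diracHNegOne (Y p.2) ∂(ν.prod ν)) =
          ∫ p, inner ℝ ((S ×ˢ T).indicator (fun p => inner ℝ e (diracHNegOne (Y p.2))) p) (g p)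
            ∂(ν.prod ν) := by
      intro g hg hgC
      rw [← integral_inner (hwδi hg hgC hY).integrableOn, ← integral_indicator (hS.prod hT)]
      refine integral_congr_ae (Eventually.of_forall fun p => ?_)
      by_cases hp : p ∈ S ×ˢ T
      · simp only [Set.indicator_of_mem hp, inner_smul_right]
        rfl
      · simp only [Set.indicator_of_notMem hp, inner_zero_left]
    have h4 : Tendsto (fun j => inner ℝ e (∫ p in S ×ˢ T, w (ψ j) p • diracHNegOne (Y p.2)
        ∂(ν.prod ν))) (hyperfilter ℕ) (𝓝 (inner ℝ e (∫ p in S ×ˢ T, u p 1 ∂(ν.prod ν)))) :=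
      (tendsto_const_nhds.inner hY1).mono_left Nat.hyperfilter_le_atTop
    refine tendsto_nhds_unique h4 ?_
    rw [hin w' hw'm hw'a]
    simp_rw [hin _ (hw _) (hwC _)]
    -- With the position frozen at `Y`, pairing with `e` leaves the scalar weight tested against a
    -- fixed bounded function, as weak convergence requires.
    refine hw' _ (MemLp.indicator (hS.prod hT) ?_)
    exact .of_bound ((hδm hY).const_inner) (‖e‖ * R) (Eventually.of_forall fun p =>
      (norm_inner_le_norm _ _).trans (mul_le_mul_of_nonneg_left (hR _) (norm_nonneg _)))
  refine ⟨w', Y, memLp_of_ae_mem_isBounded isCompact_Icc.isBounded hw'm hw'C ⊤, hY, ?_⟩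
  filter_upwards [h0, h1] with p hp0 hp1
  ext i : 1
  fin_cases i
  · exact hp0
  · exact hp1

end PairClosed

/-! ### From cut norm to cut distance, and lifting to the embedded space -/

/-- Every limit of kernels of pairs in the unlabeled cut distance is the kernel of a pair. -/
theorem exists_pair_of_tendsto_cutDist {I : ℕ → Type*} [∀ n, MeasurableSpace (I n)]
    [∀ n, StandardBorelSpace (I n)] (μ : ∀ n, Measure (I n)) [∀ n, IsProbabilityMeasure (μ n)]
    {J : Type*} [MeasurableSpace J] [StandardBorelSpace J]
    (ν : Measure J) [IsProbabilityMeasure ν] {w : ∀ n, I n × I n → ℝ}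
    {X : ∀ n, I n → UnitAddCircle} {C : ℝ}
    (hw : ∀ n, AEStronglyMeasurable (w n) ((μ n).prod (μ n)))
    (hwC : ∀ n, ∀ᵐ p ∂((μ n).prod (μ n)), |w n p| ≤ C) (hX : ∀ n, Measurable (X n))
    {u : J × J → PiLp 2 (fun _ : Fin 2 => HNegOne)} (hu : Integrable u (ν.prod ν))
    (h : Tendsto (fun n => cutDist (μ n) ν (pairKernel (w n) (X n)) u) atTop (𝓝 0)) :
    ∃ (wlim : J × J → ℝ) (Y : J → UnitAddCircle), MemLp wlim ⊤ (ν.prod ν) ∧ Measurable Y ∧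
      u =ᵐ[ν.prod ν] pairKernel wlim Y := by
  -- The chosen indices need not increase: only kernels of pairs that approach `u` after transport
  -- to `J` are required.
  have hclose : ∀ j : ℕ, ∃ n, cutDist (μ n) ν (pairKernel (w n) (X n)) u < 2⁻¹ ^ j := fun j =>
    (h.eventually (gt_mem_nhds (ENNReal.pow_pos (by simp) j))).exists
  choose n hn using hclose
  choose θ hθ hlt using fun j => exists_cutNorm_lt (hn j)
  refine exists_pair_of_tendsto_cutNorm (C := C)
    (w := fun j p => w (n j) ((θ j).symm p.1, (θ j).symm p.2))
    (X := fun j => X (n j) ∘ (θ j).symm)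
    (fun j => (hw (n j)).comp_measurePreserving ((hθ j).symm.prod (hθ j).symm))
    (fun j => ((hθ j).symm.prod (hθ j).symm).quasiMeasurePreserving.ae (hwC (n j)))
    (fun j => (hX (n j)).comp (θ j).symm.measurable) hu ?_
  have h0 := ENNReal.tendsto_pow_atTop_nhds_zero_of_lt_one (r := 2⁻¹) (by simp)
  refine tendsto_of_tendsto_of_tendsto_of_le_of_le tendsto_const_nhds h0 (fun _ => zero_le)
    fun j => ?_
  exact (cutNorm_comp_symm (hθ j) (pairKernel (w (n j)) (X (n j))) u).trans_le (hlt j).le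

theorem cutDist_congr_right {I J H : Type*} [MeasurableSpace I] [MeasurableSpace J]
    [NormedAddCommGroup H] [InnerProductSpace ℝ H] {μ : Measure I} {ν : Measure J} [SFinite μ]
    [SFinite ν] (w : I × I → H) {u v : J × J → H} (h : u =ᵐ[ν.prod ν] v) :
    cutDist μ ν w u = cutDist μ ν w v := by
  refine iInf_congr fun Φ => iInf_congr fun _ => iInf_congr fun hΦ => cutNorm_congr_ae ?_
  filter_upwards [(hΦ.prod hΦ).quasiMeasurePreserving.ae h] with p hp
  exact congrArg (w p - ·) hp

open scoped Pointwise in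
/-- A kernel with values in the closure of the image of a ball lifts to the embedded space if the
image of the unit ball is closed. -/
theorem exists_memLInfty_lift {Ω B H : Type*} [MeasurableSpace Ω] {P : Measure Ω}
    [NormedAddCommGroup B] [NormedSpace ℝ B] [NormedAddCommGroup H] [NormedSpace ℝ H]
    (ι : B →L[ℝ] H) (hclosed : IsClosed (ι '' Metric.closedBall (0 : B) 1)) {u : Ω → H} {r : ℝ}
    (hu : AEStronglyMeasurable u P)
    (hur : ∀ᵐ p ∂P, u p ∈ closure (ι '' Metric.closedBall (0 : B) r)) :
    ∃ w : Ω → B, MemLInfty ι P w ∧ u =ᵐ[P] fun p => ι (w p) := by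
  classical
  -- A positive radius makes the image of the ball a nonzero dilate of the image of the unit ball,
  -- hence closed, whatever the sign of `r`.
  set R := max r 1 with hR
  have hR0 : 0 < R := lt_max_of_lt_right one_pos
  have hball : ι '' Metric.closedBall (0 : B) R = R • (ι '' Metric.closedBall (0 : B) 1) := by
    rw [← image_smul_set, smul_closedBall _ _ zero_le_one, smul_zero, mul_one,
      Real.norm_of_nonneg hR0.le]
  have hclosedR : IsClosed (ι '' Metric.closedBall (0 : B) R) := by
    rw [hball]
    exact hclosed.smul_of_ne_zero hR0.ne'
  have huR : ∀ᵐ p ∂P, u p ∈ ι '' Metric.closedBall (0 : B) R := hur.mono fun p hp =>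
    closure_minimal (Set.image_mono (Metric.closedBall_subset_closedBall (le_max_left r 1)))
      hclosedR hp
  let w : Ω → B := fun p => if h : u p ∈ ι '' Metric.closedBall (0 : B) R then h.choose else 0
  have hw : ∀ᵐ p ∂P, ‖w p‖ ≤ R ∧ ι (w p) = u p := huR.mono fun p hp => by
    have hp' := hp.choose_spec
    simp only [w, dif_pos hp]
    exact ⟨mem_closedBall_zero_iff.mp hp'.1, hp'.2⟩
  have huw : u =ᵐ[P] fun p => ι (w p) := hw.mono fun p hp => hp.2.symm
  exact ⟨w, ⟨hu.congr huw, R, hw.mono fun p hp => hp.1⟩, huw⟩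

end CutCompactness

end

/-! ### The compactness lemma -/

theorem lemma2p14
    {I : ℕ → Type*} [∀ n, MeasurableSpace (I n)] [∀ n, StandardBorelSpace (I n)]
    (μ : ∀ n, Measure (I n)) [∀ n, IsProbabilityMeasure (μ n)] [∀ n, NullSingletonClass (μ n)]
    {J : Type*} [MeasurableSpace J] [StandardBorelSpace J]
    (ν : Measure J) [IsProbabilityMeasure ν] [NullSingletonClass ν]
    {B : Type*} [NormedAddCommGroup B] [NormedSpace ℝ B] [CompleteSpace B]
    {H : Type*} [NormedAddCommGroup H] [InnerProductSpace ℝ H] [CompleteSpace H]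
    [TopologicalSpace.SeparableSpace H]
    (ι : B →L[ℝ] H) (hι : CutCompactness.IsCompactEmbedding ι) :
    -- compactness for kernels with values in `B`
    (∀ (w : ∀ n, I n × I n → B) (wmax : ℝ),
      (∀ n, CutCompactness.MemLInfty ι ((μ n).prod (μ n)) (w n)) →
      (∀ n, ∀ᵐ p ∂((μ n).prod (μ n)), ‖w n p‖ ≤ wmax) →
      ∃ φ : ℕ → ℕ, StrictMono φ ∧ ∃ u : J × J → H,
        MemLp u ⊤ (ν.prod ν) ∧
        (∀ᵐ p ∂(ν.prod ν), u p ∈ closure (ι '' Metric.closedBall (0 : B) wmax)) ∧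
        Tendsto (fun k => CutCompactness.cutDist (μ (φ k)) ν (fun p => ι (w (φ k) p)) u)
          atTop (𝓝 0) ∧
        (IsClosed (ι '' Metric.closedBall (0 : B) 1) →
          ∃ wlim : J × J → B, CutCompactness.MemLInfty ι (ν.prod ν) wlim ∧
            u =ᵐ[ν.prod ν] fun p => ι (wlim p))) ∧
    -- kernels that come from pairs
    (∀ (w : ∀ n, I n × I n → ℝ) (X : ∀ n, I n → UnitAddCircle) (wmax : ℝ),
      (∀ n, AEStronglyMeasurable (w n) ((μ n).prod (μ n))) →
      (∀ n, ∀ᵐ p ∂((μ n).prod (μ n)), |w n p| ≤ wmax) →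
      (∀ n, Measurable (X n)) →
      -- some subsequence converges to the kernel of a pair
      (∃ φ : ℕ → ℕ, StrictMono φ ∧ ∃ (wlim : J × J → ℝ) (Xlim : J → UnitAddCircle),
        MemLp wlim ⊤ (ν.prod ν) ∧ Measurable Xlim ∧
        Tendsto (fun k => CutCompactness.cutDist (μ (φ k)) ν
          (CutCompactness.pairKernel (w (φ k)) (X (φ k)))
          (CutCompactness.pairKernel wlim Xlim)) atTop (𝓝 0)) ∧
      -- every limit of a subsequence is the kernel of a pair
      (∀ φ : ℕ → ℕ, StrictMono φ →
        ∀ u : J × J → PiLp 2 (fun _ : Fin 2 => CutCompactness.HNegOne),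
        MemLp u ⊤ (ν.prod ν) →
        Tendsto (fun k => CutCompactness.cutDist (μ (φ k)) ν
          (CutCompactness.pairKernel (w (φ k)) (X (φ k))) u) atTop (𝓝 0) →
        ∃ (wlim : J × J → ℝ) (Xlim : J → UnitAddCircle),
          MemLp wlim ⊤ (ν.prod ν) ∧ Measurable Xlim ∧
          u =ᵐ[ν.prod ν] CutCompactness.pairKernel wlim Xlim)) := by
  refine ⟨fun w wmax hw hwmax => ?_, fun w X wmax hw hwmax hX => ⟨?_, ?_⟩⟩
  · have hK : IsCompact (closure (ι '' Metric.closedBall (0 : B) wmax)) :=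
      hι.compact.isCompact_closure_image_closedBall wmax
    have hconv : Convex ℝ (closure (ι '' Metric.closedBall (0 : B) wmax)) :=
      ((convex_closedBall (0 : B) wmax).linear_image ι.toLinearMap).closure
    obtain ⟨φ, hφ, u, hu, huK, hlim⟩ := CutCompactness.exists_subseq_tendsto_cutDist μ ν hK hconv
      (fun n => (hw n).measurable) fun n => (hwmax n).mono fun p hp =>
        subset_closure ⟨w n p, mem_closedBall_zero_iff.mpr hp, rfl⟩
    exact ⟨φ, hφ, u, CutCompactness.memLp_of_ae_mem_isBounded hK.isBounded hu huK ⊤, huK, hlim,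
      fun hclosed => CutCompactness.exists_memLInfty_lift ι hclosed hu huK⟩
  -- The set of values is compact but not convex, so compactness is applied to its closed convex
  -- hull; that the limit is nevertheless a pair comes from the closedness result.
  · have hG := (CutCompactness.isCompact_image_pairValue wmax).totallyBounded
    have hK : IsCompact (closure (convexHull ℝ
        (CutCompactness.pairValue '' (Set.univ ×ˢ Set.Icc (-wmax) wmax)))) :=
      hG.convexHull.closure.isCompact_of_isClosed isClosed_closure
    obtain ⟨φ, hφ, u, hu, huK, hlim⟩ := CutCompactness.exists_subseq_tendsto_cutDist μ ν hK
      (convex_convexHull ℝ _).closure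
      (fun n => CutCompactness.aestronglyMeasurable_pairKernel (hw n) (hX n)) fun n =>
        (CutCompactness.ae_pairKernel_mem (hwmax n) (X n)).mono fun p hp =>
          subset_closure (subset_convexHull ℝ _ hp)
    obtain ⟨wlim, Xlim, hwlim, hXlim, heq⟩ := CutCompactness.exists_pair_of_tendsto_cutDist
      (fun k => μ (φ k)) ν (fun k => hw (φ k)) (fun k => hwmax (φ k)) (fun k => hX (φ k))
      (CutCompactness.integrable_of_ae_mem_isBounded hK.isBounded hu huK) hlim
    refine ⟨φ, hφ, wlim, Xlim, hwlim, hXlim, ?_⟩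
    simpa only [CutCompactness.cutDist_congr_right _ heq] using hlim
  · intro φ _ u hu hlim
    exact CutCompactness.exists_pair_of_tendsto_cutDist (fun k => μ (φ k)) ν
      (fun k => hw (φ k)) (fun k => hwmax (φ k)) (fun k => hX (φ k)) (hu.integrable le_top) hlim
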